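/- Let $k$ be a field of characteristic $0$, $n\ge 1$ and $Z_+=\{0,1,2,\dots\}$. For $m,l\in Z_+^n$ write $m\prec l$ if $m_i\le l_i$ for all $i$ and $m_i<l_i$ for some $i$; put $(-1)^s=(-1)^{s_1+\cdots+s_n}$, $\binom ms=\prod_i\binom{m_i}{s_i}$, and let $e_i$ be the $i$-th unit vector. An associative $n$-conformal algebra is a $k$-vector space $C$ with bilinear products $\langle m\rangle$ ($m\in Z_+^n$) and commuting linear maps $D_1,\dots,D_n$ such that, for all $a,b,c\in C$, $m,m'\in Z_+^n$ and $1\le i\le n$: (1) there is $M\in Z_+^n$, depending only on $a,b$, with $a\langle l\rangle b=0$ for all $l\not\prec M$; (2) $D_i(a\langle m\rangle b)=(D_ia)\langle m\rangle b+a\langle m\rangle(D_ib)$; (3) $(D_ia)\langle m\rangle b=-m_i\,a\langle m-e_i\rangle b$ (read as $0$ if $m_i=0$); (4) $(a\langle m\rangle b)\langle m'\rangle c=\sum_{s\in Z_+^n,\ s\le m}(-1)^s\binom ms\,a\langle m-s\rangle(b\langle m'+s\rangle c)$. A homomorphism is a linear map commuting with all products $\langle m\rangle$ and all $D_i$. Let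 $B$ be a non-empty set and $N:B\times B\to Z_+^n$ any map. A normal word is an expression $a_1\langle m^{(1)}\rangle(a_2\langle m^{(2)}\rangle(\cdots(a_t\langle m^{(t)}\rangle D^{i}a_{t+1})\cdots))$ with $t\ge 0$, $a_j\in B$, $i\in Z_+^n$, $D^i=D_1^{i_1}\cdots D_n^{i_n}$, and $m^{(j)}\prec N(a_j,a_{j+1})$ for $1\le j\le t$. Let $C=C(B,N,D_1,\dots,D_n)$ be the $k$-vector space with basis the set of all normal words, with linear maps $D_j$ and bilinear products $\langle m\rangle$ defined on normal words recursively as follows, where $a,b\in B$ and $u,v,w$ are normal words. - $D_j(D^ib)=D^{i+e_j}b$ and $D_j(a\langle m\rangle w)=-m_j\,a\langle m-e_j\rangle w+a\langle m\rangle D_jw$. - $a\langle m\rangle D^ib$ is the normal word so written if $m\prec N(a,b)$. If $m\not\prec N(a,b)$, it is $0$ when $i=0$, and otherwise, for a chosen $j$ with $i_j>0$, it equals $D_j(a\langle m\rangle D^{i-e_j}b)+m_j\,a\langle m-e_j\rangle D^{i-e_j}b$. - $a\langle m\rangle(b\langle m'\rangle w)$, for a normal word $b\langle m'\rangle w$,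 is the normal word so written if $m\prec N(a,b)$. If $m\not\prec N(a,b)$, replace it by $-\sum_{0\ne s\le m}(-1)^s\binom ms\,a\langle m-s\rangle(b\langle m'+s\rangle w)$, repeat this until all first indices $l$ satisfy $l\prec N(a,b)$, then rewrite each shorter product $b\langle l'\rangle w$ by the same rules as a combination of normal words starting with $b$, and multiply it by $a\langle l\rangle$ on the left. - $(D^ia)\langle m\rangle v=(-1)^i\prod_j m_j(m_j-1)\cdots(m_j-i_j+1)\;a\langle m-i\rangle v$ (which is $0$ unless $i\le m$). - $(a\langle m'\rangle u)\langle m\rangle v=\sum_{s\le m'}(-1)^s\binom{m'}s\,a\langle m'-s\rangle(u\langle m+s\rangle v)$, for a normal word $a\langle m'\rangle u$. Theorem. $C(B,N,D_1,\dots,D_n)$ is the free associative $n$-conformal algebra with the data $(B,N,D_1,\dots,D_n)$. That is: with these operations it is an associative $n$-conformal algebra; it is generated by $B$ (the only linear subspace containing $B$ and closed under all products and all $D_i$ is $C$); $a\langle m\rangle b=0$ in $C$ for $a,b\in B$ and $m\not\prec N(a,b)$; and for every associative $n$-conformal algebra $C'$ over $k$ and every map $\varepsilon:B\to C'$ such that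 $\varepsilon(a)\langle m\rangle\varepsilon(b)=0$ whenever $a,b\in B$ and $m\not\prec N(a,b)$, there is a unique homomorphism $f:C\to C'$ with $f(b)=\varepsilon(b)$ for all $b\in B$. -/

import Mathlib

/-!
Multi-indices `m = (m₁, …, mₙ)` of nonnegative integers are functions `Fin n → ℕ`.  The pointwise
strict order `m < l` of Mathlib on them says exactly `mᵢ ≤ lᵢ` for all `i` and `mᵢ < lᵢ` for some
`i` (`Pi.lt_def`); it is the relation `m ≺ l` used for locality.  `Pi.single i 1` is the
multi-index `eᵢ`.
-/

namespace NConformal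

/-- `(-1)^(s₁ + ⋯ + sₙ)`. -/
def sgn (k : Type*) [Field k] {n : ℕ} (s : Fin n → ℕ) : k := (-1) ^ (∑ i, s i)

/-- The multi-binomial coefficient `∏ᵢ binom(mᵢ, sᵢ)`. -/
def binom (k : Type*) [Field k] {n : ℕ} (m s : Fin n → ℕ) : k := ∏ i, ((m i).choose (s i) : k)

/-- The multi-falling factorial `∏ᵢ mᵢ (mᵢ - 1) ⋯ (mᵢ - sᵢ + 1)`. -/
def falling (k : Type*) [Field k] {n : ℕ} (m s : Fin n → ℕ) : k :=
  ∏ i, ((m i).descFactorial (s i) : k)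

/-! ### Associative `n`-conformal algebras -/

/-- The operations of an `n`-conformal algebra on a `k`-space `C`: a bilinear product `⟨m⟩` for every
multi-index `m`, and linear maps `D₁, …, Dₙ`. -/
structure Ops (k : Type*) [Field k] (n : ℕ) (C : Type*) [AddCommGroup C] [Module k C] where
  /-- `prod m a b` is `a ⟨m⟩ b`. -/
  prod : (Fin n → ℕ) → C →ₗ[k] C →ₗ[k] C
  /-- The derivations. -/
  D : Fin n → C →ₗ[k] C

/-- The axioms of an associative `n`-conformal algebra.  In `D_prod` the right-hand side is `0` when
`m i = 0`; in `assoc` the summands with `s ≰ m` vanish because their binomial coefficient does. -/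
structure Ops.IsAssocConformal {k : Type*} [Field k] {n : ℕ} {C : Type*} [AddCommGroup C]
    [Module k C] (S : Ops k n C) : Prop where
  D_comm : ∀ i j a, S.D i (S.D j a) = S.D j (S.D i a)
  locality : ∀ a b, ∃ M : Fin n → ℕ, ∀ m, ¬ m < M → S.prod m a b = 0
  leibniz : ∀ i m a b, S.D i (S.prod m a b) = S.prod m (S.D i a) b + S.prod m a (S.D i b)
  D_prod : ∀ i m a b, S.prod m (S.D i a) b = -((m i : k) • S.prod (m - Pi.single i 1) a b)
  assoc : ∀ m m' a b c, S.prod m' (S.prod m a b) c =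
    ∑ s ∈ Finset.Iic m, (sgn k s * binom k m s) • S.prod (m - s) a (S.prod (m' + s) b c)

/-- A linear map is a homomorphism if it respects all products and all derivations. -/
structure IsHom {k : Type*} [Field k] {n : ℕ} {C C' : Type*} [AddCommGroup C] [Module k C]
    [AddCommGroup C'] [Module k C'] (S : Ops k n C) (S' : Ops k n C') (f : C →ₗ[k] C') : Prop where
  map_prod : ∀ m a b, f (S.prod m a b) = S'.prod m (f a) (f b)
  map_D : ∀ i a, f (S.D i a) = S'.D i (f a)

/-- `ε : B → C` is compatible with the locality function `N` on `B`. -/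
def LocalMap {k : Type*} [Field k] {n : ℕ} {B C : Type*} [AddCommGroup C] [Module k C]
    (N : B → B → Fin n → ℕ) (S : Ops k n C) (ε : B → C) : Prop :=
  ∀ a b m, ¬ m < N a b → S.prod m (ε a) (ε b) = 0

/-- The image of `ι` generates: a subspace that contains it and is closed under all derivations and
all products is everything. -/
def Generates {k : Type*} [Field k] {n : ℕ} {B C : Type*} [AddCommGroup C] [Module k C]
    (S : Ops k n C) (ι : B → C) : Prop :=
  ∀ W : Submodule k C, (∀ b, ι b ∈ W) → (∀ i, ∀ x ∈ W, S.D i x ∈ W) →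
    (∀ m, ∀ x ∈ W, ∀ y ∈ W, S.prod m x y ∈ W) → W = ⊤

/-- `(C, S)` together with `ι : B → C` is the free associative `n`-conformal algebra with the data
`(B, N, D₁, …, Dₙ)`.  The universe `w` of the test algebras is arbitrary. -/
structure IsFree.{w, x, y, z} {k : Type x} [Field k] {n : ℕ} {B : Type y} {C : Type z}
    [AddCommGroup C] [Module k C] (N : B → B → Fin n → ℕ) (S : Ops k n C) (ι : B → C) : Prop where
  isAssocConformal : S.IsAssocConformal
  generates : Generates S ι
  localMap : LocalMap N S ι
  existsUnique_hom : ∀ (C' : Type w) [AddCommGroup C'] [Module k C'] (S' : Ops k n C'),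
    S'.IsAssocConformal → ∀ ε : B → C', LocalMap N S' ε →
      ∃! f : C →ₗ[k] C', IsHom S S' f ∧ ∀ b, f (ι b) = ε b

/-! ### Normal words -/

/-- The normal words whose first letter is `a`:
`a₁⟨m⁽¹⁾⟩(a₂⟨m⁽²⁾⟩(⋯(a_t⟨m⁽ᵗ⁾⟩ D₁^{i₁}⋯Dₙ^{iₙ} a_{t+1})⋯))` with `m⁽ʲ⁾ ≺ N(a_j, a_{j+1})` and `a₁ = a`. -/
inductive NormalWord {n : ℕ} {B : Type*} (N : B → B → Fin n → ℕ) : B → Type _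
  /-- The word `D₁^{i₁} ⋯ Dₙ^{iₙ} b` of length one. -/
  | last (b : B) (i : Fin n → ℕ) : NormalWord N b
  /-- The word `a ⟨m⟩ w`, where `b` is the first letter of `w`. -/
  | cons (a : B) {b : B} (m : Fin n → ℕ) (h : m < N a b) (w : NormalWord N b) : NormalWord N a

/-- The underlying space of `C(B, N, D₁, …, Dₙ)`: the `k`-space with basis all normal words. -/
abbrev FreeSpace (k : Type*) [Field k] {n : ℕ} {B : Type*} (N : B → B → Fin n → ℕ) : Type _ :=
  (Σ b : B, NormalWord N b) →₀ k

section Operations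

variable (k : Type*) [Field k] {n : ℕ} {B : Type*} (N : B → B → Fin n → ℕ)

/-- `D_t` on a normal word:
`D_t (D^i b) = D^{i + e_t} b` and `D_t (a⟨m⟩w) = -m_t a⟨m - e_t⟩w + a⟨m⟩ D_t w`. -/
noncomputable def derivWord (t : Fin n) : {a : B} → NormalWord N a → (NormalWord N a →₀ k)
  | _, .last b i => Finsupp.single (.last b (i + Pi.single t 1)) 1
  | _, .cons a m h w =>
      -((m t : k) • Finsupp.single (.cons a (m - Pi.single t 1) (tsub_le_self.trans_lt h) w) 1)
        + (derivWord t w).mapDomain (.cons a m h)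

open Classical in
/-- The normal form of `a⟨m⟩ D^i b` (length two).  If `m ≺ N(a,b)` the word is normal.  Otherwise it
is `0` if `i = 0`, and for some `t` with `i_t > 0` it is
`D_t (a⟨m⟩ D^{i - e_t} b) + m_t a⟨m - e_t⟩ D^{i - e_t} b`. -/
noncomputable def lastMul (a b : B) (m i : Fin n → ℕ) : NormalWord N a →₀ k :=
  if hm : m < N a b then Finsupp.single (.cons a m hm (.last b i)) 1
  else if hi : i = 0 then 0
  else
    let t := (Function.ne_iff.mp hi).choose
    Finsupp.linearCombination k (derivWord k N t) (lastMul a b m (i - Pi.single t 1))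
      + (m t : k) • lastMul a b (m - Pi.single t 1) (i - Pi.single t 1)
termination_by ∑ j, i j
decreasing_by
  all_goals
    have ht : i (Function.ne_iff.mp hi).choose ≠ 0 := (Function.ne_iff.mp hi).choose_spec
    refine Finset.sum_lt_sum (fun _ _ => Nat.sub_le _ _) ⟨(Function.ne_iff.mp hi).choose, Finset.mem_univ _, ?_⟩
    simp only [Pi.sub_apply, Pi.single_eq_same]
    omega

open Classical in
/-- Reduction of the first index of `a⟨m⟩(b⟨m'⟩v)` where `M = N(a,b)`: while `m ⊀ M`, replace
`a⟨m⟩(b⟨m'⟩v)` by `-∑_{s ≠ 0} (-1)^s binom(m,s) a⟨m-s⟩(b⟨m'+s⟩v)`.  The result is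
`∑_{l ≺ M} c_l a⟨l⟩(b⟨m' + (m - l)⟩v)`, and `reduceIndex k M m` is the family `(c_l)`; every `l`
that occurs satisfies `l ≤ m`. -/
noncomputable def reduceIndex (M m : Fin n → ℕ) : {l : Fin n → ℕ // l < M} →₀ k :=
  if hm : m < M then Finsupp.single ⟨m, hm⟩ 1
  else -∑ s ∈ ((Finset.Iic m).erase 0).attach,
    (sgn k s.1 * binom k m s.1) • reduceIndex M (m - s.1)
termination_by ∑ j, m j
decreasing_by
  obtain ⟨s, hs⟩ := s
  rw [Finset.mem_erase, Finset.mem_Iic] at hs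
  obtain ⟨j, hj⟩ := Function.ne_iff.mp hs.1
  refine Finset.sum_lt_sum (fun _ _ => Nat.sub_le _ _) ⟨j, Finset.mem_univ _, ?_⟩
  have h1 : s j ≤ m j := hs.2 j
  have h2 : s j ≠ 0 := hj
  change m j - s j < m j
  omega

open Classical in
/-- The normal form of `a⟨m⟩v` for a letter `a` and a normal word `v`.  For `v = b⟨m'⟩v'` the word is
normal if `m ≺ N(a,b)`; otherwise its first index is reduced and then the algorithm is applied to
the words `b⟨m' + (m - l)⟩v'`, which have smaller length. -/
noncomputable def letterMul : {b : B} → NormalWord N b → (a : B) → (Fin n → ℕ) →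
    (NormalWord N a →₀ k)
  | _, .last b i, a, m => lastMul k N a b m i
  | _, .cons b m' h v, a, m =>
      if hm : m < N a b then Finsupp.single (.cons a m hm (.cons b m' h v)) 1
      else (reduceIndex k (N a b) m).sum fun l c =>
        c • (letterMul v b (m' + (m - l.1))).mapDomain (.cons a l.1 l.2)

/-- The normal form of `u⟨m⟩v` for normal words `u`, `v`:
`(D^i a)⟨m⟩v = (-1)^i m(m-1)⋯(m-i+1) a⟨m - i⟩v` (which is `0` unless `i ≤ m`), and
`(a⟨m'⟩u')⟨m⟩v = ∑_{s ≤ m'} (-1)^s binom(m',s) a⟨m' - s⟩(u'⟨m + s⟩v)`. -/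
noncomputable def wordMul {b : B} (v : NormalWord N b) : {a : B} → NormalWord N a → (Fin n → ℕ) →
    (NormalWord N a →₀ k)
  | _, .last a i, m => (sgn k i * falling k m i) • letterMul k N v a (m - i)
  | _, .cons a m' _ u, m => ∑ s ∈ Finset.Iic m', (sgn k s * binom k m' s) •
      Finsupp.linearCombination k (fun w => letterMul k N w a (m' - s)) (wordMul v u (m + s))

/-- The operations on `C(B, N, D₁, …, Dₙ)`, extended linearly from normal words. -/
noncomputable def freeOps : Ops k n (FreeSpace k N) where
  prod m := Finsupp.linearCombination k fun u => Finsupp.linearCombination k fun v =>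
    (wordMul k N v.2 u.2 m).mapDomain (Sigma.mk u.1)
  D t := Finsupp.linearCombination k fun u => (derivWord k N t u.2).mapDomain (Sigma.mk u.1)

/-- The letter `b`, as a normal word of length one in `C(B, N, D₁, …, Dₙ)`. -/
noncomputable def gen (b : B) : FreeSpace k N := Finsupp.single ⟨b, .last b 0⟩ 1

end Operations

end NConformal

universe w

namespace NConformal

open Finset

/-! ### Polynomials whose linear functionals encode families with several multi-indices. -/

section Binomial

variable {k : Type*} [Field k] {n : ℕ}

/-! A family F(m,q) of vectors is treated as the linear functional x^m y^q ↦ F(m,q) on polynomials.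
The signed binomial sum in the associativity axiom (`bsum`) is then its value on (x - y)^m y^q, and
identities between nested sums become polynomial identities. The substitution x - y = (x - z) - (y -
z) gives `bsum_comp`, which is associativity at the level of indices. The derivation ∂/∂x + ∂/∂y
gives `bsum_deriv`, which governs D_j.

For F(m,q) = a⟨m⟩(b⟨q⟩x), locality of a and b together with associativity forces the functional to
kill (x - y)^m y^q for every m ⊀ N(a,b). Such a functional is determined by its values with first
index l ≺ N(a,b), with universal coefficients (`eq_reduceSum`). Conversely, every choice of those
values extends to one (`bsum_reduceSum`). The rewriting rule for normal words is exactly this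
extension.

It remains to see that the operations so defined satisfy the axioms. All words with first letter a
form one space, on which D_t, the letter action a⟨m⟩ and the products act linearly. The Leibniz rule
for letters (`derivOp_letterOp`) comes first. It yields the locality relation for two letters acting
on an arbitrary word (`bsum_letterOp`). That relation gives associativity when the left factor is a
letter (`mulOp_letterOp`), and induction on the left word gives it in general (`mulOp_mulOp`). In
any other algebra with local generators the same vanishing holds, so evaluating normal words
respects the rewriting (`evalOp_letterOp`) and defines a homomorphism. Uniqueness follows from
generation. -/

theorem Iic_eq_piFinset (m : Fin n → ℕ) : Iic m = Fintype.piFinset fun i => Iic (m i) := by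
  ext s
  simp [Pi.le_def]

/-- The multi-index power `∏ᵢ uᵢ ^ mᵢ` in a commutative monoid. -/
def mpow {A : Type*} [CommMonoid A] (u : Fin n → A) (m : Fin n → ℕ) : A := ∏ i, u i ^ m i

theorem mpow_add {A : Type*} [CommMonoid A] (u : Fin n → A) (m l : Fin n → ℕ) :
    mpow u (m + l) = mpow u m * mpow u l := by
  simp [mpow, pow_add, prod_mul_distrib]

theorem mpow_sub_eq_sum {A : Type*} [CommRing A] [Algebra k A] (u v : Fin n → A) (m : Fin n → ℕ) :
    mpow (u - v) m = ∑ s ∈ Iic m, (sgn k s * binom k m s) • (mpow u (m - s) * mpow v s) := by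
  have h : ∀ i, (u i - v i) ^ m i = ∑ j ∈ Iic (m i),
      ((-1 : k) ^ j * ((m i).choose j : k)) • (u i ^ (m i - j) * v i ^ j) := by
    intro i
    rw [sub_eq_neg_add, add_pow, Nat.range_succ_eq_Iic]
    refine sum_congr rfl fun j _ => ?_
    rw [Algebra.smul_def, neg_pow]
    simp only [map_mul, map_pow, map_neg, map_one, map_natCast]
    ring
  simp only [mpow, Pi.sub_apply, h, prod_univ_sum, ← Iic_eq_piFinset]
  refine sum_congr rfl fun s _ => ?_
  simp only [Algebra.smul_def, sgn, binom, prod_mul_distrib, map_mul, map_prod, map_pow,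
    ← prod_pow_eq_pow_sum]

theorem mpow_add_eq_sum {A : Type*} [CommRing A] [Algebra k A] (u v : Fin n → A) (m : Fin n → ℕ) :
    mpow (u + v) m = ∑ s ∈ Iic m, binom k m s • (mpow u (m - s) * mpow v s) := by
  have h : ∀ i, (u i + v i) ^ m i = ∑ j ∈ Iic (m i),
      ((m i).choose j : k) • (u i ^ (m i - j) * v i ^ j) := by
    intro i
    rw [add_comm, add_pow, Nat.range_succ_eq_Iic]
    refine sum_congr rfl fun j _ => ?_
    rw [Algebra.smul_def]
    simp only [map_natCast]
    ring
  simp only [mpow, Pi.add_apply, h, prod_univ_sum, ← Iic_eq_piFinset]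
  refine sum_congr rfl fun s _ => ?_
  simp only [Algebra.smul_def, binom, prod_mul_distrib, map_prod]
  rfl

section Functional

variable (k) (n) in
/-- The polynomial algebra in three groups of `n` variables, with its monomial basis. -/
abbrev Poly : Type _ := AddMonoidAlgebra k ((Fin n → ℕ) × (Fin n → ℕ) × (Fin n → ℕ))

/-- The monomial `x^m y^q z^r`. -/
noncomputable def mon (k : Type*) [Field k] {n : ℕ} (m q r : Fin n → ℕ) : Poly k n :=
  AddMonoidAlgebra.single (m, q, r) 1

theorem mon_mul (m q r m' q' r' : Fin n → ℕ) :
    mon k m q r * mon k m' q' r' = mon k (m + m') (q + q') (r + r') := by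
  simp [mon, AddMonoidAlgebra.single_mul_single]

/-- The variables `xᵢ`. -/
noncomputable def varX (k : Type*) [Field k] {n : ℕ} (i : Fin n) : Poly k n :=
  mon k (Pi.single i 1) 0 0
/-- The variables `yᵢ`. -/
noncomputable def varY (k : Type*) [Field k] {n : ℕ} (i : Fin n) : Poly k n :=
  mon k 0 (Pi.single i 1) 0
/-- The variables `zᵢ`. -/
noncomputable def varZ (k : Type*) [Field k] {n : ℕ} (i : Fin n) : Poly k n :=
  mon k 0 0 (Pi.single i 1)

theorem mon_eq (m q r : Fin n → ℕ) :
    mon k m q r = mpow (varX k) m * mpow (varY k) q * mpow (varZ k) r := by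
  -- An additive map g turns the decomposition m = ∑ m_i e_i into a product of powers; the three
  -- coordinate inclusions give the three groups of variables.
  have key : ∀ (g : (Fin n → ℕ) →+ (Fin n → ℕ) × (Fin n → ℕ) × (Fin n → ℕ)) (m : Fin n → ℕ),
      (AddMonoidAlgebra.single (g m) 1 : Poly k n) =
        mpow (fun i => AddMonoidAlgebra.single (g (Pi.single i 1)) 1) m := by
    intro g m
    have h := Finset.univ_sum_single m
    simp only [mpow, AddMonoidAlgebra.single_pow, one_pow, ← map_nsmul]
    conv_lhs => rw [← h, map_sum]
    have := map_prod (AddMonoidAlgebra.of k ((Fin n → ℕ) × (Fin n → ℕ) × (Fin n → ℕ)))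
      (fun i => Multiplicative.ofAdd (g (Pi.single i (m i)))) univ
    rw [← ofAdd_sum] at this
    simp only [AddMonoidAlgebra.of_apply, toAdd_ofAdd] at this
    rw [this]
    refine prod_congr rfl fun i _ => ?_
    congr 2
    rw [← Pi.single_smul]
    simp
  have h1 := key (AddMonoidHom.inl _ _) m
  have h2 := key ((AddMonoidHom.inr _ _).comp (AddMonoidHom.inl _ _)) q
  have h3 := key ((AddMonoidHom.inr _ _).comp (AddMonoidHom.inr _ _)) r
  have e : mon k m q r = mon k m 0 0 * mon k 0 q 0 * mon k 0 0 r := by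
    simp [mon_mul]
  rw [e]
  congr 1
  congr 1

variable {V : Type*} [AddCommGroup V] [Module k V]

/-- The linear functional on polynomials with prescribed values on monomials. -/
noncomputable def evalMon (F : (Fin n → ℕ) → (Fin n → ℕ) → (Fin n → ℕ) → V) : Poly k n →ₗ[k] V :=
  (Finsupp.linearCombination k fun g => F g.1 g.2.1 g.2.2) ∘ₗ
    (AddMonoidAlgebra.coeffLinearEquiv k).toLinearMap

theorem evalMon_mon (F : (Fin n → ℕ) → (Fin n → ℕ) → (Fin n → ℕ) → V) (m q r : Fin n → ℕ) :
    evalMon (k := k) F (mpow (varX k) m * mpow (varY k) q * mpow (varZ k) r) = F m q r := by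
  rw [← mon_eq]
  simp [evalMon, mon]

end Functional

end Binomial

/-! ### Calculus of binomial sums: expansion, shift, substitution and derivation. -/

section BinomialSums

variable (k : Type*) [Field k] {n : ℕ} {V : Type*} [AddCommGroup V] [Module k V]

/-- The binomial sum `∑_{s ≤ m} (-1)^s binom(m,s) F(m - s, q + s)`, the value on
`(x - y)^m y^q` of the linear functional with `x^m y^q ↦ F(m, q)`. -/
def bsum (F : (Fin n → ℕ) → (Fin n → ℕ) → V) (m q : Fin n → ℕ) : V :=
  ∑ s ∈ Iic m, (sgn k s * binom k m s) • F (m - s) (q + s)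

variable {k}

theorem sgn_zero : sgn k (0 : Fin n → ℕ) = 1 := by simp [sgn]

theorem sgn_add (s t : Fin n → ℕ) : sgn k (s + t) = sgn k s * sgn k t := by
  simp [sgn, sum_add_distrib, pow_add]

theorem sgn_single (j : Fin n) : sgn k (Pi.single j 1 : Fin n → ℕ) = -1 := by
  simp [sgn]

theorem binom_zero_right (m : Fin n → ℕ) : binom k m 0 = 1 := by simp [binom]

theorem binom_eq_zero {m s : Fin n → ℕ} (h : ¬ s ≤ m) : binom k m s = 0 := by
  obtain ⟨i, hi⟩ := not_forall.mp h
  exact prod_eq_zero (mem_univ i) (by rw [Nat.choose_eq_zero_of_lt (not_le.mp hi), Nat.cast_zero])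

/-- The binomial expansion of (x - y)^m has exactly the coefficients of `bsum`; z^r is a passive
factor. -/
theorem evalMon_sub (F : (Fin n → ℕ) → (Fin n → ℕ) → (Fin n → ℕ) → V) (m q r : Fin n → ℕ) :
    evalMon (k := k) F (mpow (varX k - varY k) m * mpow (varY k) q * mpow (varZ k) r) =
      bsum k (fun m q => F m q r) m q := by
  rw [mpow_sub_eq_sum (k := k), sum_mul, sum_mul, map_sum, bsum]
  refine sum_congr rfl fun s _ => ?_
  rw [smul_mul_assoc, smul_mul_assoc, map_smul, mul_assoc (mpow (varX k) _), ← mpow_add,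
    evalMon_mon, add_comm s q]

/-- Multiplication by x^p preserves the span of the (x - y)^m y^q with m ⊀ M: write x = (x - y) + y
and expand x^p. Powers of x - y only grow, and the condition m ⊀ M is closed upwards. -/
theorem bsum_shift {M : Fin n → ℕ} {F : (Fin n → ℕ) → (Fin n → ℕ) → V}
    (hF : ∀ m, ¬ m < M → ∀ q, bsum k F m q = 0) (p : Fin n → ℕ) (m : Fin n → ℕ) (hm : ¬ m < M)
    (q : Fin n → ℕ) : bsum k (fun m q => F (m + p) q) m q = 0 := by
  let G : (Fin n → ℕ) → (Fin n → ℕ) → (Fin n → ℕ) → V := fun m q _ => F m q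
  have h1 : bsum k (fun m q => F (m + p) q) m q = evalMon (k := k) G
      (mpow (varX k) p * (mpow (varX k - varY k) m * mpow (varY k) q * mpow (varZ k) 0)) := by
    rw [mpow_sub_eq_sum (k := k), sum_mul, sum_mul, mul_sum, map_sum, bsum]
    refine sum_congr rfl fun s _ => ?_
    rw [smul_mul_assoc, smul_mul_assoc, mul_smul_comm, map_smul, mul_assoc (mpow (varX k) _),
      ← mpow_add, ← mul_assoc, ← mul_assoc, ← mpow_add, evalMon_mon, add_comm s q, add_comm p]
  have h2 : (varX k : Fin n → Poly k n) = (varX k - varY k) + varY k := by simp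
  rw [h1, h2, mpow_add_eq_sum (k := k), ← h2, sum_mul, map_sum]
  refine sum_eq_zero fun s _ => ?_
  have e : ∀ a b c d f : Poly k n, a * b * (c * d * f) = (c * a) * (d * b) * f := by
    intros; ring
  rw [smul_mul_assoc, map_smul, e, ← mpow_add, ← mpow_add, evalMon_sub]
  refine smul_eq_zero_of_right _ (hF _ (fun h => hm ?_) _)
  exact lt_of_le_of_lt (le_add_of_nonneg_right (zero_le)) h

/-- The substitution `x ↦ x - z`, `y ↦ y - z` turns `(x - y)^m y^q z^r` into
`(x - y)^m (y - z)^q z^r`. -/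
theorem bsum_comp (F : (Fin n → ℕ) → (Fin n → ℕ) → (Fin n → ℕ) → V) (m q r : Fin n → ℕ) :
    bsum k (fun m q => bsum k (fun i r => bsum k (fun j r => F i j r) q r) m r) m q =
      bsum k (fun j r => bsum k (fun i j => F i j r) m j) q r := by
  have key : ∀ m q, evalMon (k := k) F
      (mpow (varX k - varZ k) m * mpow (varY k - varZ k) q * mpow (varZ k) r) =
        bsum k (fun i r => bsum k (fun j r => F i j r) q r) m r := by
    intro m q
    rw [mpow_sub_eq_sum (k := k), mpow_sub_eq_sum (k := k), sum_mul, sum_mul, map_sum, bsum]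
    refine sum_congr rfl fun s _ => ?_
    rw [smul_mul_assoc, smul_mul_assoc, map_smul, mul_sum, sum_mul, map_sum, bsum]
    congr 1
    refine sum_congr rfl fun t _ => ?_
    have e : ∀ a b c d f : Poly k n, a * b * (c * d) * f = a * c * (f * b * d) := by
      intros; ring
    rw [mul_smul_comm, smul_mul_assoc, map_smul, e, ← mpow_add, ← mpow_add, evalMon_mon]
  have h1 : evalMon (k := k) F
      (mpow (varX k - varY k) m * mpow (varY k - varZ k) q * mpow (varZ k) r) =
      bsum k (fun m q => bsum k (fun i r => bsum k (fun j r => F i j r) q r) m r) m q := by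
    have h2 : (varX k - varY k : Fin n → Poly k n) = (varX k - varZ k) - (varY k - varZ k) := by
      simp
    rw [h2, mpow_sub_eq_sum (k := k), sum_mul, sum_mul, map_sum, bsum]
    refine sum_congr rfl fun s _ => ?_
    rw [smul_mul_assoc, smul_mul_assoc, map_smul, mul_assoc (mpow (varX k - varZ k) _),
      ← mpow_add, key, add_comm s q]
  rw [← h1, mpow_sub_eq_sum (k := k) (varY k), mul_sum, sum_mul, map_sum, bsum]
  refine sum_congr rfl fun s _ => ?_
  rw [mul_smul_comm, smul_mul_assoc, map_smul, ← evalMon_sub, ← mul_assoc,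
    mul_assoc _ (mpow (varZ k) _), ← mpow_add, add_comm s r]

theorem single_one_le {j : Fin n} {m : Fin n → ℕ} (h : 0 < m j) : Pi.single j 1 ≤ m := by
  intro i
  rcases eq_or_ne i j with rfl | hi
  · simpa using Nat.succ_le_of_lt h
  · simp [hi]

/-- Absorption in coordinate j. Truncated subtraction is harmless, because both sides vanish when
m_j = 0. -/
theorem sub_mul_binom (j : Fin n) (m s : Fin n → ℕ) :
    (((m - s) j : ℕ) : k) * binom k m s = (m j : k) * binom k (m - Pi.single j 1) s := by
  have h : ∏ i ∈ univ.erase j, (((m - Pi.single j 1 : Fin n → ℕ) i).choose (s i) : k) =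
      ∏ i ∈ univ.erase j, ((m i).choose (s i) : k) := by
    refine prod_congr rfl fun i hi => ?_
    simp [Pi.single_eq_of_ne (ne_of_mem_erase hi)]
  rw [binom, binom, ← mul_prod_erase univ _ (mem_univ j), ← mul_prod_erase univ _ (mem_univ j), h,
    ← mul_assoc, ← mul_assoc]
  congr 1
  simp only [Pi.sub_apply, Pi.single_eq_same]
  norm_cast
  cases hm : m j with
  | zero => simp
  | succ a => rw [mul_comm, ← Nat.choose_mul_succ_eq, mul_comm]; rfl

theorem succ_mul_binom (j : Fin n) (m s : Fin n → ℕ) :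
    (((s + Pi.single j 1 : Fin n → ℕ) j : ℕ) : k) * binom k m (s + Pi.single j 1) =
      (m j : k) * binom k (m - Pi.single j 1) s := by
  have h : ∏ i ∈ univ.erase j, (((m - Pi.single j 1 : Fin n → ℕ) i).choose (s i) : k) =
      ∏ i ∈ univ.erase j, ((m i).choose ((s + Pi.single j 1 : Fin n → ℕ) i) : k) := by
    refine prod_congr rfl fun i hi => ?_
    simp [Pi.single_eq_of_ne (ne_of_mem_erase hi)]
  rw [binom, binom, ← mul_prod_erase univ _ (mem_univ j), ← mul_prod_erase univ _ (mem_univ j), h,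
    ← mul_assoc, ← mul_assoc]
  congr 1
  simp only [Pi.sub_apply, Pi.add_apply, Pi.single_eq_same]
  norm_cast
  cases hm : m j with
  | zero => simp
  | succ a => rw [Nat.add_sub_cancel, Nat.add_one_mul_choose_eq, mul_comm]

theorem sum_Iic_eq_of_le {m l : Fin n → ℕ} (h : l ≤ m) (G : (Fin n → ℕ) → V) :
    ∑ s ∈ Iic m, (sgn k s * binom k l s) • G s = ∑ s ∈ Iic l, (sgn k s * binom k l s) • G s := by
  refine (sum_subset (Iic_subset_Iic.mpr h) fun s _ hs => ?_).symm
  rw [binom_eq_zero (by simpa using hs), mul_zero, zero_smul]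

theorem sum_sub_smul (j : Fin n) (m : Fin n → ℕ) (G : (Fin n → ℕ) → V) :
    ∑ s ∈ Iic m, (sgn k s * binom k m s) • (((m - s) j : ℕ) : k) • G s =
      (m j : k) • ∑ s ∈ Iic (m - Pi.single j 1),
        (sgn k s * binom k (m - Pi.single j 1) s) • G s := by
  rw [← sum_Iic_eq_of_le (tsub_le_self : m - Pi.single j 1 ≤ m), smul_sum]
  refine sum_congr rfl fun s _ => ?_
  rw [smul_smul, smul_smul, mul_assoc, mul_comm (binom k m s), sub_mul_binom]
  congr 1
  ring

theorem sum_self_smul (j : Fin n) (m : Fin n → ℕ) (G : (Fin n → ℕ) → V) :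
    ∑ s ∈ Iic m, (sgn k s * binom k m s) • (s j : k) • G s =
      -((m j : k) • ∑ s ∈ Iic (m - Pi.single j 1),
        (sgn k s * binom k (m - Pi.single j 1) s) • G (s + Pi.single j 1)) := by
  rcases Nat.eq_zero_or_pos (m j) with hm | hm
  · rw [hm, Nat.cast_zero, zero_smul, neg_zero]
    refine sum_eq_zero fun s hs => ?_
    have : s j = 0 := Nat.le_zero.mp (hm ▸ mem_Iic.mp hs j)
    simp [this]
  -- Reindex by s = t + e_j; the terms missed, those with s_j = 0, carry the factor s_j and vanish.
  -- The sign comes from the parity shift of s.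
  · have hsub : (Iic (m - Pi.single j 1)).map (addRightEmbedding (Pi.single j 1)) ⊆ Iic m := by
      intro s hs
      obtain ⟨t, ht, rfl⟩ := mem_map.mp hs
      rw [mem_Iic] at ht ⊢
      refine (add_le_add_left ht _).trans (tsub_add_cancel_of_le (single_one_le hm)).le
    rw [← sum_subset hsub, sum_map, smul_sum, ← sum_neg_distrib]
    · refine sum_congr rfl fun s _ => ?_
      rw [addRightEmbedding_apply, smul_smul, smul_smul, mul_assoc, mul_comm (binom k m _),
        succ_mul_binom, sgn_add, sgn_single, ← neg_smul]
      congr 1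
      ring
    · intro s hs hs'
      have : s j = 0 := by
        by_contra h0
        refine hs' (mem_map.mpr ⟨s - Pi.single j 1, ?_, ?_⟩)
        · rw [mem_Iic] at hs ⊢
          exact tsub_le_tsub_right hs _
        · exact tsub_add_cancel_of_le (single_one_le (Nat.pos_of_ne_zero h0))
      simp [this]

/-- The derivation `∂/∂x_j + ∂/∂y_j` maps `(x - y)^m y^q` to `q_j (x - y)^m y^(q - e_j)`. -/
theorem bsum_deriv (j : Fin n) (F : (Fin n → ℕ) → (Fin n → ℕ) → V) (m q : Fin n → ℕ) :
    bsum k (fun m q => (m j : k) • F (m - Pi.single j 1) q + (q j : k) • F m (q - Pi.single j 1))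
      m q = (q j : k) • bsum k F m (q - Pi.single j 1) := by
  simp only [bsum, smul_add, sum_add_distrib]
  have h2 : ∀ s, (((q + s) j : ℕ) : k) • F (m - s) (q + s - Pi.single j 1) =
      (q j : k) • F (m - s) (q - Pi.single j 1 + s) +
        (s j : k) • F (m - s) (q + s - Pi.single j 1) := by
    intro s
    rw [Pi.add_apply, Nat.cast_add, add_smul]
    congr 1
    rcases Nat.eq_zero_or_pos (q j) with hq | hq
    · simp [hq]
    · rw [tsub_add_eq_add_tsub (single_one_le hq)]
  simp only [h2, smul_add, sum_add_distrib]
  have h4 := sum_sub_smul (k := k) j m (fun s => F (m - s - Pi.single j 1) (q + s))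
  have h5 := sum_self_smul (k := k) j m (fun s => F (m - s) (q + s - Pi.single j 1))
  rw [h4, h5]
  have h3 : ∀ s : Fin n → ℕ, F (m - (s + Pi.single j 1)) (q + (s + Pi.single j 1) - Pi.single j 1)
      = F (m - s - Pi.single j 1) (q + s) := by
    intro s
    rw [← add_assoc, add_tsub_cancel_right, tsub_add_eq_tsub_tsub]
  simp only [h3, smul_sum, smul_comm (q j : k)]
  abel

theorem bsum_eq_add (F : (Fin n → ℕ) → (Fin n → ℕ) → V) (m q : Fin n → ℕ) :
    bsum k F m q = F m q +
      ∑ s ∈ (Iic m).erase 0, (sgn k s * binom k m s) • F (m - s) (q + s) := by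
  rw [bsum, ← add_sum_erase (Iic m) _ (mem_Iic.mpr zero_le)]
  simp [sgn_zero, binom_zero_right]

end BinomialSums

/-! ### Reduction of the first index below the locality bound. -/

section Reduce

variable {k : Type*} [Field k] {n : ℕ} {V : Type*} [AddCommGroup V] [Module k V]

theorem sum_sub_lt {m s : Fin n → ℕ} (hs : s ∈ (Iic m).erase 0) : ∑ j, (m - s) j < ∑ j, m j := by
  rw [mem_erase, mem_Iic] at hs
  obtain ⟨j, hj⟩ := Function.ne_iff.mp hs.1
  refine sum_lt_sum (fun _ _ => Nat.sub_le _ _) ⟨j, mem_univ _, ?_⟩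
  have h1 : s j ≤ m j := hs.2 j
  have h2 : s j ≠ 0 := hj
  change m j - s j < m j
  omega

theorem reduceIndex_of_lt {M m : Fin n → ℕ} (hm : m < M) :
    reduceIndex k M m = Finsupp.single ⟨m, hm⟩ 1 := by
  rw [reduceIndex, dif_pos hm]

theorem reduceIndex_of_not_lt {M m : Fin n → ℕ} (hm : ¬ m < M) :
    reduceIndex k M m = -∑ s ∈ (Iic m).erase 0,
      (sgn k s * binom k m s) • reduceIndex k M (m - s) := by
  rw [reduceIndex, dif_neg hm, ← sum_attach ((Iic m).erase 0)]

/-- Every index in the reduction of `m` is at most `m`. -/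
theorem le_of_mem_support_reduceIndex (M : Fin n → ℕ) (m : Fin n → ℕ)
    (l : {l : Fin n → ℕ // l < M}) (hl : l ∈ (reduceIndex k M m).support) : l.1 ≤ m := by
  by_cases hm : m < M
  · rw [reduceIndex_of_lt hm] at hl
    rw [Finset.mem_singleton.mp (Finsupp.support_single_subset hl)]
  · rw [reduceIndex_of_not_lt hm, Finsupp.support_neg] at hl
    obtain ⟨s, hs, h⟩ := Finsupp.mem_support_finsetSum _ hl
    have := sum_sub_lt hs
    exact (le_of_mem_support_reduceIndex M (m - s) l (Finsupp.support_smul h)).trans tsub_le_self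
termination_by ∑ j, m j

/-- The reduction `∑_{l < M} c_l G(l, q + (m - l))` of `G(m, q)`. -/
noncomputable def reduceSum (k : Type*) [Field k] {V : Type*} [AddCommGroup V] [Module k V]
    (M : Fin n → ℕ) (G : {l : Fin n → ℕ // l < M} → (Fin n → ℕ) → V) (m q : Fin n → ℕ) : V :=
  (reduceIndex k M m).sum fun l c => c • G l (q + (m - l.1))

theorem reduceSum_of_lt {M : Fin n → ℕ} (G : {l : Fin n → ℕ // l < M} → (Fin n → ℕ) → V)
    {m : Fin n → ℕ} (hm : m < M) (q : Fin n → ℕ) : reduceSum k M G m q = G ⟨m, hm⟩ q := by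
  rw [reduceSum, reduceIndex_of_lt hm, Finsupp.sum_single_index (by simp)]
  simp

/-- The recursion defining `reduceIndex` is the equation `bsum` = 0 solved for its s = 0 term. -/
theorem bsum_reduceSum {M : Fin n → ℕ} (G : {l : Fin n → ℕ // l < M} → (Fin n → ℕ) → V)
    {m : Fin n → ℕ} (hm : ¬ m < M) (q : Fin n → ℕ) : bsum k (reduceSum k M G) m q = 0 := by
  have h : reduceSum k M G m q = -∑ s ∈ (Iic m).erase 0,
      (sgn k s * binom k m s) • reduceSum k M G (m - s) (q + s) := by
    have e : ∀ f : {l : Fin n → ℕ // l < M} →₀ k, (f.sum fun l c => c • G l (q + (m - l.1))) =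
        Finsupp.linearCombination k (fun l => G l (q + (m - l.1))) f := fun f =>
      (Finsupp.linearCombination_apply k f).symm
    rw [reduceSum, e, reduceIndex_of_not_lt hm, map_neg, map_sum]
    congr 1
    refine sum_congr rfl fun s hs => ?_
    rw [map_smul, ← e, reduceSum]
    congr 1
    refine Finsupp.sum_congr fun l hl => ?_
    -- Since l ≤ m - s, truncated subtraction is exact and q + s + (m - s - l) = q + (m - l).
    have h1 := le_of_mem_support_reduceIndex M _ l hl
    rw [mem_erase, mem_Iic] at hs
    congr 2
    funext i
    have h2 := h1 i
    have h3 := hs.2 i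
    simp only [Pi.add_apply, Pi.sub_apply] at h2 h3 ⊢
    omega
  rw [bsum_eq_add, h, neg_add_cancel]

/-- Vanishing of `bsum` expresses G(m,q) through the G(m - s, q + s) with s ≠ 0, whose first index
has smaller total degree. Both sides obey this recursion and agree for m < M. -/
theorem eq_reduceSum {M : Fin n → ℕ} {G : (Fin n → ℕ) → (Fin n → ℕ) → V}
    (hG : ∀ m, ¬ m < M → ∀ q, bsum k G m q = 0) (m q : Fin n → ℕ) :
    G m q = reduceSum k M (fun l q => G l.1 q) m q := by
  by_cases hm : m < M
  · rw [reduceSum_of_lt _ hm]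
  · have h1 := hG m hm q
    have h2 := bsum_reduceSum (k := k) (fun l q => G l.1 q) hm q
    rw [bsum_eq_add] at h1 h2
    rw [eq_neg_of_add_eq_zero_left h1, eq_neg_of_add_eq_zero_left h2]
    congr 1
    refine sum_congr rfl fun s hs => ?_
    have := sum_sub_lt hs
    rw [eq_reduceSum hG (m - s) (q + s)]
termination_by ∑ j, m j

end Reduce

/-! ### The derivations and the action of a letter on normal words. -/

section Letters

variable {n : ℕ}

theorem multiIndex_induction {P : (Fin n → ℕ) → Prop} (zero : P 0)
    (add_single : ∀ i j, P i → P (i + Pi.single j 1)) (i : Fin n → ℕ) : P i := by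
  by_cases hi : i = 0
  · rwa [hi]
  · obtain ⟨j, hj⟩ := Function.ne_iff.mp hi
    have hj : 0 < i j := Nat.pos_of_ne_zero hj
    have h : i - Pi.single j 1 + Pi.single j 1 = i := tsub_add_cancel_of_le (single_one_le hj)
    have hlt : ∑ l, (i - Pi.single j 1 : Fin n → ℕ) l < ∑ l, i l := by
      conv_rhs => rw [← h]
      simp [sum_add_distrib]
    rw [← h]
    exact add_single _ _ (multiIndex_induction zero add_single _)
termination_by ∑ l, i l

/-- Symmetry of the mixed second derivative of x^m, needed wherever D_s and D_t are interchanged. -/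
theorem mul_sub_single_comm (m : Fin n → ℕ) (s t : Fin n) :
    m t * (m - Pi.single t 1 : Fin n → ℕ) s = m s * (m - Pi.single s 1 : Fin n → ℕ) t := by
  rcases eq_or_ne s t with rfl | h
  · rfl
  · simp [Pi.single_eq_of_ne h, Pi.single_eq_of_ne h.symm, mul_comm]

variable {k : Type*} [Field k] {B : Type*} {N : B → B → Fin n → ℕ}

variable (k) in
/-- The basis vector of a normal word. -/
noncomputable def word {a : B} (w : NormalWord N a) : NormalWord N a →₀ k := Finsupp.single w 1

/-- A property stable under linear combinations holds if it holds for all normal words. -/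
theorem word_induction {a : B} {P : (NormalWord N a →₀ k) → Prop} (x : NormalWord N a →₀ k)
    (zero : P 0) (add : ∀ x y, P x → P y → P (x + y)) (smul : ∀ (c : k) x, P x → P (c • x))
    (basis : ∀ w : NormalWord N a, P (word k w)) : P x := by
  refine Finsupp.induction_linear x zero add fun w c => ?_
  have := smul c _ (basis w)
  rwa [word, Finsupp.smul_single, smul_eq_mul, mul_one] at this

/-- The linear extension of `D_t` to the combinations of normal words with first letter `a`. -/
noncomputable def derivOp (t : Fin n) {a : B} : (NormalWord N a →₀ k) →ₗ[k] (NormalWord N a →₀ k) :=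
  Finsupp.linearCombination k (derivWord k N t)

/-- The linear extension of `w ↦ a⟨m⟩w` for `m < N a b`, where `b` is the first letter of `w`. -/
noncomputable def consOp (a : B) {b : B} (m : {m : Fin n → ℕ // m < N a b}) :
    (NormalWord N b →₀ k) →ₗ[k] (NormalWord N a →₀ k) :=
  Finsupp.lmapDomain k k (.cons a m.1 m.2)

/-- The linear extension of `w ↦ a⟨m⟩w`. -/
noncomputable def letterOp (a : B) {b : B} (m : Fin n → ℕ) :
    (NormalWord N b →₀ k) →ₗ[k] (NormalWord N a →₀ k) :=
  Finsupp.linearCombination k fun w => letterMul k N w a m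

theorem derivOp_word (t : Fin n) {a : B} (w : NormalWord N a) :
    derivOp t (word k w) = derivWord k N t w := by
  simp [derivOp, word]

theorem letterOp_word (a : B) {b : B} (m : Fin n → ℕ) (w : NormalWord N b) :
    letterOp a m (word k w) = letterMul k N w a m := by
  simp [letterOp, word]

theorem consOp_word (a : B) {b : B} (m : {m : Fin n → ℕ // m < N a b}) (w : NormalWord N b) :
    consOp a m (word k w) = word k (.cons a m.1 m.2 w) := by
  simp [consOp, word]

theorem letterOp_of_lt (a : B) {b : B} {m : Fin n → ℕ} (hm : m < N a b)
    (x : NormalWord N b →₀ k) : letterOp a m x = consOp a ⟨m, hm⟩ x := by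
  induction x using word_induction with
  | zero => simp
  | add x y hx hy => simp [hx, hy]
  | smul c x hx => simp [hx]
  | basis w =>
    rw [letterOp_word, consOp_word]
    cases w with
    | last b i => rw [letterMul, lastMul, dif_pos hm, word]
    | cons b m' h v => rw [letterMul, dif_pos hm, word]

theorem derivOp_last (t : Fin n) (b : B) (i : Fin n → ℕ) :
    derivOp t (word k (.last b i : NormalWord N b)) = word k (.last b (i + Pi.single t 1)) := by
  rw [derivOp_word, derivWord, word]

theorem derivOp_letterOp_of_lt (t : Fin n) (a : B) {b : B} {m : Fin n → ℕ} (hm : m < N a b)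
    (x : NormalWord N b →₀ k) : derivOp t (letterOp a m x) =
      -((m t : k) • letterOp a (m - Pi.single t 1) x) + letterOp a m (derivOp t x) := by
  have hm' : m - Pi.single t 1 < N a b := tsub_le_self.trans_lt hm
  rw [letterOp_of_lt a hm, letterOp_of_lt a hm, letterOp_of_lt a hm']
  induction x using word_induction with
  | zero => simp
  | add x y hx hy =>
    simp only [map_add, hx, hy, smul_add]
    abel
  | smul c x hx => simp only [map_smul, hx, smul_add, smul_neg, smul_comm c]
  | basis w =>
    rw [consOp_word, derivOp_word, derivOp_word, derivWord, consOp_word]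
    rfl

theorem letterOp_letterOp_of_lt (a b : B) {c : B} (m : Fin n → ℕ) {q : Fin n → ℕ}
    (hq : q < N b c) (x : NormalWord N c →₀ k) : letterOp a m (letterOp b q x) =
      reduceSum k (N a b) (fun l q => consOp a l (letterOp b q x)) m q := by
  by_cases hm : m < N a b
  · rw [reduceSum_of_lt _ hm, letterOp_of_lt a hm]
  · rw [letterOp_of_lt b hq]
    induction x using word_induction with
    | zero => simp [reduceSum]
    | add x y hx hy => simp only [map_add, hx, hy, reduceSum, smul_add, Finsupp.sum_add]
    | smul c x hx => simp only [map_smul, hx, reduceSum, Finsupp.smul_sum, smul_comm c]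
    | basis w =>
      rw [consOp_word, letterOp_word, letterMul, dif_neg hm]
      simp only [letterOp_word]
      rfl

theorem derivOp_comm (s t : Fin n) {a : B} (x : NormalWord N a →₀ k) :
    derivOp s (derivOp t x) = derivOp t (derivOp s x) := by
  induction x using word_induction with
  | zero => simp
  | add x y hx hy => simp [hx, hy]
  | smul c x hx => simp [hx]
  | basis w =>
    induction w with
    | last b i => simp only [derivOp_last, add_right_comm]
    | cons a m h v ih =>
      have hs := fun t => (tsub_le_self : m - Pi.single t 1 ≤ m).trans_lt h
      rw [← consOp_word a ⟨m, h⟩, ← letterOp_of_lt]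
      simp only [derivOp_letterOp_of_lt _ a h, map_add, map_neg, map_smul,
        derivOp_letterOp_of_lt _ a (hs _), ih, smul_add, smul_neg, smul_smul, ← Nat.cast_mul,
        mul_sub_single_comm m s t, tsub_right_comm (b := Pi.single s 1)]
      abel

theorem lastMul_of_not_lt {a b : B} {m : Fin n → ℕ} (hm : ¬ m < N a b) {i : Fin n → ℕ}
    (hi : i ≠ 0) : ∃ t, 0 < i t ∧ lastMul k N a b m i =
      derivOp t (lastMul k N a b m (i - Pi.single t 1)) +
        (m t : k) • lastMul k N a b (m - Pi.single t 1) (i - Pi.single t 1) := by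
  refine ⟨(Function.ne_iff.mp hi).choose,
    Nat.pos_of_ne_zero (Function.ne_iff.mp hi).choose_spec, ?_⟩
  rw [lastMul, dif_neg hm, dif_neg hi]
  rfl

/-- Independence of the coordinate chosen in `lastMul`. If the choice t differs from j, remove e_t
first, apply induction for j to what is left, and use that D_t and D_j commute. -/
theorem lastMul_add_single (a b : B) (i : Fin n → ℕ) (m : Fin n → ℕ) (j : Fin n) :
    lastMul k N a b m (i + Pi.single j 1) = derivOp j (lastMul k N a b m i) +
      (m j : k) • lastMul k N a b (m - Pi.single j 1) i := by
  by_cases hm : m < N a b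
  · have h : ∀ m i, lastMul k N a b m i = letterOp a m (word k (.last b i)) := by
      intro m i
      rw [letterOp_word, letterMul]
    rw [h, h, h, derivOp_letterOp_of_lt j a hm, derivOp_last]
    abel
  · obtain ⟨t, ht, h⟩ := lastMul_of_not_lt (k := k) hm
      (i := i + Pi.single j 1) (fun h => by simpa using congrFun h j)
    rcases eq_or_ne t j with rfl | htj
    · rwa [add_tsub_cancel_right] at h
    · have hit : 0 < i t := by simpa [htj] using ht
      have e : i - Pi.single t 1 + Pi.single t 1 = i := tsub_add_cancel_of_le (single_one_le hit)
      have hlt : ∑ l, (i - Pi.single t 1 : Fin n → ℕ) l < ∑ l, i l := by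
        conv_rhs => rw [← e]
        simp [sum_add_distrib]
      rw [h, ← tsub_add_eq_add_tsub (single_one_le hit)]
      conv_rhs => rw [← e]
      generalize i - Pi.single t 1 = i' at *
      simp only [lastMul_add_single a b i', map_add, map_smul, smul_add, smul_smul, ← Nat.cast_mul,
        mul_sub_single_comm m t j, derivOp_comm t j, tsub_right_comm (b := Pi.single j 1)]
      abel
termination_by ∑ l, i l

/-- `D_t (a⟨m⟩x) = -m_t a⟨m - e_t⟩x + a⟨m⟩D_t x`. -/
theorem derivOp_letterOp (t : Fin n) (a : B) {b : B} (m : Fin n → ℕ)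
    (x : NormalWord N b →₀ k) : derivOp t (letterOp a m x) =
      -((m t : k) • letterOp a (m - Pi.single t 1) x) + letterOp a m (derivOp t x) := by
  induction x using word_induction with
  | zero => simp
  | add x y hx hy =>
    simp only [map_add, hx, hy, smul_add]
    abel
  | smul c x hx => simp only [map_smul, hx, smul_add, smul_neg, smul_comm c]
  | basis w =>
    induction w generalizing a m with
    | last b i =>
      rw [derivOp_last, letterOp_word, letterOp_word, letterOp_word, letterMul, letterMul, letterMul,
        lastMul_add_single]
      abel
    | @cons b c r h v ih =>
      have hs := (tsub_le_self : r - Pi.single t 1 ≤ r).trans_lt h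
      rw [← consOp_word b ⟨r, h⟩, ← letterOp_of_lt, derivOp_letterOp_of_lt t b h, map_add, map_neg,
        map_smul, letterOp_letterOp_of_lt a b m h, letterOp_letterOp_of_lt a b m h,
        letterOp_letterOp_of_lt a b m hs, letterOp_letterOp_of_lt a b _ h]
      -- F is defined by reduction for all second indices, so it satisfies the locality relation by
      -- construction; `bsum_letterOp` is not available yet, as its proof uses the present result.
      set F := reduceSum k (N a b) fun l q => consOp a l (letterOp b q (word k v)) with hF
      -- H is F composed with ∂/∂x_t + ∂/∂y_t. By `bsum_deriv` it inherits the vanishing of F, hence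
      -- equals its own reduction, and it suffices to compare at first indices below N(a,b), where
      -- the induction hypothesis applies.
      set H : (Fin n → ℕ) → (Fin n → ℕ) → (NormalWord N a →₀ k) := fun m q =>
        (m t : k) • F (m - Pi.single t 1) q + (q t : k) • F m (q - Pi.single t 1) with hH
      have hbsum : ∀ m, ¬ m < N a b → ∀ q, bsum k H m q = 0 := by
        intro m hm q
        rw [hH, bsum_deriv, bsum_reduceSum _ hm, smul_zero]
      have key := eq_reduceSum hbsum m r
      have hl : ∀ (l : {l : Fin n → ℕ // l < N a b}) q,
          derivOp t (consOp a l (letterOp b q (word k v))) =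
            -H l.1 q + consOp a l (letterOp b q (derivOp t (word k v))) := by
        intro l q
        have hlt := (tsub_le_self : l.1 - Pi.single t 1 ≤ l.1).trans_lt l.2
        rw [← letterOp_of_lt a l.2, derivOp_letterOp_of_lt t a l.2, ih, hH, hF]
        simp only
        rw [reduceSum_of_lt _ l.2, reduceSum_of_lt _ hlt, letterOp_of_lt a hlt,
          letterOp_of_lt a l.2]
        simp only [map_add, map_neg, map_smul, Subtype.coe_eta]
        abel
      have h1 : derivOp t (F m r) = -H m r + reduceSum k (N a b)
          (fun l q => consOp a l (letterOp b q (derivOp t (word k v)))) m r := by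
        rw [key, hF]
        simp only [reduceSum, Finsupp.sum, map_sum, map_smul, hl, smul_add, smul_neg,
          sum_add_distrib, sum_neg_distrib]
      rw [h1, hH]
      simp only
      abel

end Letters

/-! ### Linearity and partial derivatives of binomial sums; falling factorials. -/

section Bsum

variable {k : Type*} [Field k] {n : ℕ} {V W : Type*} [AddCommGroup V] [Module k V]
  [AddCommGroup W] [Module k W]

theorem map_bsum (f : V →ₗ[k] W) (F : (Fin n → ℕ) → (Fin n → ℕ) → V) (m q : Fin n → ℕ) :
    f (bsum k F m q) = bsum k (fun m q => f (F m q)) m q := by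
  simp [bsum]

theorem map_reduceSum (f : V →ₗ[k] W) {M : Fin n → ℕ}
    (F : {l : Fin n → ℕ // l < M} → (Fin n → ℕ) → V) (m q : Fin n → ℕ) :
    f (reduceSum k M F m q) = reduceSum k M (fun m q => f (F m q)) m q := by
  simp [reduceSum, Finsupp.sum]

theorem bsum_add (F G : (Fin n → ℕ) → (Fin n → ℕ) → V) (m q : Fin n → ℕ) :
    bsum k (fun m q => F m q + G m q) m q = bsum k F m q + bsum k G m q := by
  simp [bsum, sum_add_distrib]

theorem bsum_neg (F : (Fin n → ℕ) → (Fin n → ℕ) → V) (m q : Fin n → ℕ) :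
    bsum k (fun m q => -F m q) m q = -bsum k F m q := by
  simp [bsum]

theorem bsum_smul (c : k) (F : (Fin n → ℕ) → (Fin n → ℕ) → V) (m q : Fin n → ℕ) :
    bsum k (fun m q => c • F m q) m q = c • bsum k F m q := by
  simp [bsum, smul_sum, smul_comm c]

theorem bsum_zero (m q : Fin n → ℕ) : bsum k (fun _ _ => (0 : V)) m q = 0 := by
  simp [bsum]

theorem bsum_deriv_fst (j : Fin n) (F : (Fin n → ℕ) → (Fin n → ℕ) → V) (m q : Fin n → ℕ) :
    bsum k (fun m q => (m j : k) • F (m - Pi.single j 1) q) m q =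
      (m j : k) • bsum k F (m - Pi.single j 1) q := by
  have := sum_sub_smul (k := k) j m (fun s => F (m - s - Pi.single j 1) (q + s))
  rw [bsum, this]
  simp only [bsum, tsub_right_comm (b := Pi.single j 1)]

/-- ∂/∂y_j is the total derivation of `bsum_deriv` minus ∂/∂x_j. -/
theorem bsum_deriv_snd (j : Fin n) (F : (Fin n → ℕ) → (Fin n → ℕ) → V) (m q : Fin n → ℕ) :
    bsum k (fun m q => (q j : k) • F m (q - Pi.single j 1)) m q =
      (q j : k) • bsum k F m (q - Pi.single j 1) -
        (m j : k) • bsum k F (m - Pi.single j 1) q := by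
  have := bsum_deriv (k := k) j F m q
  rw [bsum_add, bsum_deriv_fst] at this
  rw [← this, add_sub_cancel_left]

theorem falling_add_single (j : Fin n) (m i : Fin n → ℕ) :
    falling k m (i + Pi.single j 1) = (m j : k) * falling k (m - Pi.single j 1) i := by
  have h : ∏ l ∈ univ.erase j, (((m - Pi.single j 1 : Fin n → ℕ) l).descFactorial (i l) : k) =
      ∏ l ∈ univ.erase j, ((m l).descFactorial ((i + Pi.single j 1 : Fin n → ℕ) l) : k) := by
    refine prod_congr rfl fun l hl => ?_
    simp [Pi.single_eq_of_ne (ne_of_mem_erase hl)]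
  rw [falling, falling, ← mul_prod_erase univ _ (mem_univ j), ← mul_prod_erase univ _ (mem_univ j),
    h, ← mul_assoc]
  congr 1
  simp only [Pi.sub_apply, Pi.add_apply, Pi.single_eq_same]
  norm_cast
  cases hm : m j with
  | zero => simp
  | succ a => rw [Nat.succ_descFactorial_succ, Nat.add_sub_cancel]

/-- Peels off the last factor, while `falling_add_single` peels off the first; comparing the two
gives the Leibniz rule for a left factor D^i a. -/
theorem falling_add_single' (j : Fin n) (m i : Fin n → ℕ) :
    falling k m (i + Pi.single j 1) = (((m - i) j : ℕ) : k) * falling k m i := by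
  have h : ∏ l ∈ univ.erase j, ((m l).descFactorial (i l) : k) =
      ∏ l ∈ univ.erase j, ((m l).descFactorial ((i + Pi.single j 1 : Fin n → ℕ) l) : k) := by
    refine prod_congr rfl fun l hl => ?_
    simp [Pi.single_eq_of_ne (ne_of_mem_erase hl)]
  rw [falling, falling, ← mul_prod_erase univ _ (mem_univ j), ← mul_prod_erase univ _ (mem_univ j),
    h, ← mul_assoc]
  congr 1
  simp only [Pi.sub_apply, Pi.add_apply, Pi.single_eq_same, Nat.descFactorial_succ, Nat.cast_mul]

theorem falling_zero_right (m : Fin n → ℕ) : falling k m 0 = 1 := by simp [falling]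

end Bsum

/-! ### The locality relation for two letters acting on a word. -/

section Locality

variable {k : Type*} [Field k] {n : ℕ} {B : Type*} {N : B → B → Fin n → ℕ}

theorem letterOp_last_zero {a b : B} {m : Fin n → ℕ} (hm : ¬ m < N a b) :
    letterOp a m (word k (.last b 0 : NormalWord N b)) = 0 := by
  rw [letterOp_word, letterMul, lastMul, dif_neg hm, dif_pos rfl]

/-- The locality relation follows from the reduction formula for all second indices. -/
theorem bsum_letterOp_of_reduceSum {a b c : B} {x : NormalWord N c →₀ k}
    (h : ∀ m q, letterOp a m (letterOp b q x) =
      reduceSum k (N a b) (fun l q => consOp a l (letterOp b q x)) m q)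
    {m : Fin n → ℕ} (hm : ¬ m < N a b) (q : Fin n → ℕ) :
    bsum k (fun m q => letterOp a m (letterOp b q x)) m q = 0 := by
  simp only [h]
  exact bsum_reduceSum _ hm q

/-- `(a⟨m⟩b)⟨q⟩x = 0` for `m ⊀ N(a,b)`, written out by associativity. -/
theorem bsum_letterOp (a b : B) {c : B} {m : Fin n → ℕ} (hm : ¬ m < N a b) (q : Fin n → ℕ)
    (x : NormalWord N c →₀ k) :
    bsum k (fun m q => letterOp a m (letterOp b q x)) m q = 0 := by
  induction x using word_induction with
  | zero => simp [bsum]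
  | add x y hx hy => simp only [map_add, bsum_add, hx, hy, add_zero]
  | smul c x hx => simp only [map_smul, bsum_smul, hx, smul_zero]
  | basis w =>
  induction w generalizing a b m q with
  | last c i =>
    induction i using multiIndex_induction generalizing m q with
    | zero =>
      refine bsum_letterOp_of_reduceSum (fun m q => ?_) hm q
      by_cases hq : q < N b c
      · exact letterOp_letterOp_of_lt a b m hq _
      -- Reduction only raises the second index, so every term stays outside N(b,c) and vanishes
      -- too.
      · rw [letterOp_last_zero hq, map_zero, reduceSum]
        refine (Finset.sum_eq_zero fun l _ => ?_).symm
        have : ¬ q + (m - l.1) < N b c := fun h => hq (le_self_add.trans_lt h)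
        simp only [letterOp_last_zero this, map_zero, smul_zero]
    | add_single i j ih =>
      -- The family for D^{i+e_j} c is D_j of the family for D^i c plus its transform under ∂/∂x_j +
      -- ∂/∂y_j; both inherit the vanishing.
      have h : ∀ m q, letterOp a m (letterOp b q (word k (.last c (i + Pi.single j 1)))) =
          derivOp j (letterOp a m (letterOp b q (word k (.last c i : NormalWord N c)))) +
          ((m j : k) • letterOp a (m - Pi.single j 1) (letterOp b q (word k (.last c i))) +
          (q j : k) • letterOp a m (letterOp b (q - Pi.single j 1) (word k (.last c i)))) := by
        intro m q
        rw [derivOp_letterOp, derivOp_letterOp, derivOp_last]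
        simp only [map_add, map_neg, map_smul]
        abel
      have hd := bsum_deriv (k := k) j
        (fun m q => letterOp a m (letterOp b q (word k (.last c i : NormalWord N c)))) m q
      simp only [h, bsum_add (k := k) (fun m q => derivOp j _), hd, ih hm, smul_zero, add_zero]
      rw [← map_bsum, ih hm, map_zero]
  | @cons c d r hr v ih =>
    rw [← consOp_word c ⟨r, hr⟩, ← letterOp_of_lt]
    refine bsum_letterOp_of_reduceSum (fun m q => ?_) hm q
    by_cases hq : q < N b c
    · exact letterOp_letterOp_of_lt a b m hq _
    -- The induction hypothesis for (b,c), shifted by p, reduces b⟨q + p⟩(c⟨r⟩v) with coefficients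
    -- independent of p. Taking p = 0 on the left and p = m - l on the right, the reductions of q
    -- and of m become two finite sums that can be exchanged.
    · have h : ∀ p, letterOp b (q + p) (letterOp c r (word k v)) =
          reduceSum k (N b c) (fun l r => letterOp b (l.1 + p) (letterOp c r (word k v))) q r :=
        fun p => eq_reduceSum (k := k)
          (G := fun q r => letterOp b (q + p) (letterOp c r (word k v)))
          (bsum_shift (F := fun q r => letterOp b q (letterOp c r (word k v)))
            (fun m hm q => ih b c hm q) p) q r
      have h0 := h 0
      simp only [add_zero] at h0
      rw [h0, map_reduceSum]
      have h1 : ∀ (l : {l : Fin n → ℕ // l < N b c}) r,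
          letterOp a m (letterOp b l.1 (letterOp c r (word k v))) = reduceSum k (N a b)
            (fun l' q => consOp a l' (letterOp b q (letterOp c r (word k v)))) m l.1 :=
        fun l r => letterOp_letterOp_of_lt a b m l.2 _
      simp only [h1]
      simp only [reduceSum] at h ⊢
      simp only [h, Finsupp.sum, map_sum, map_smul, smul_sum]
      rw [sum_comm]
      exact sum_congr rfl fun _ _ => sum_congr rfl fun _ _ => smul_comm _ _ _

end Locality

/-! ### Products of words: the axioms for D and associativity. -/

section Products

variable {k : Type*} [Field k] {n : ℕ} {B : Type*} {N : B → B → Fin n → ℕ}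

/-- The bilinear extension of `(u, v) ↦ u⟨m⟩v` for normal words `u`, `v` with given first letters. -/
noncomputable def mulOp {a b : B} (m : Fin n → ℕ) :
    (NormalWord N a →₀ k) →ₗ[k] (NormalWord N b →₀ k) →ₗ[k] (NormalWord N a →₀ k) :=
  Finsupp.linearCombination k fun u => Finsupp.linearCombination k fun v => wordMul k N v u m

theorem mulOp_word {a b : B} (m : Fin n → ℕ) (u : NormalWord N a) (v : NormalWord N b) :
    mulOp m (word k u) (word k v) = wordMul k N v u m := by
  simp [mulOp, word]

theorem mulOp_last {b : B} (m : Fin n → ℕ) (a : B) (i : Fin n → ℕ) (y : NormalWord N b →₀ k) :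
    mulOp m (word k (.last a i : NormalWord N a)) y =
      (sgn k i * falling k m i) • letterOp a (m - i) y := by
  induction y using word_induction with
  | zero => simp
  | add x y hx hy => simp only [map_add, hx, hy, smul_add]
  | smul c x hx => simp only [map_smul, hx, smul_comm c]
  | basis w => rw [mulOp_word, letterOp_word, wordMul]

theorem mulOp_last_zero {b : B} (m : Fin n → ℕ) (a : B) (y : NormalWord N b →₀ k) :
    mulOp m (word k (.last a 0 : NormalWord N a)) y = letterOp a m y := by
  rw [mulOp_last, sgn_zero, falling_zero_right, tsub_zero, one_mul, one_smul]

theorem mulOp_letterOp_of_lt {a b c : B} (m : Fin n → ℕ) {l : Fin n → ℕ} (hl : l < N a b)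
    (u : NormalWord N b →₀ k) (y : NormalWord N c →₀ k) :
    mulOp m (letterOp a l u) y = bsum k (fun p q => letterOp a p (mulOp q u y)) l m := by
  rw [letterOp_of_lt a hl]
  induction u using word_induction with
  | zero => simp [bsum]
  | add x z hx hz => simp only [map_add, hx, hz, bsum_add, LinearMap.add_apply]
  | smul c x hx => simp only [map_smul, hx, bsum_smul, LinearMap.smul_apply]
  | basis u =>
    induction y using word_induction with
    | zero => simp [bsum]
    | add x z hx hz => simp only [map_add, hx, hz, bsum_add]
    | smul c x hx => simp only [map_smul, hx, bsum_smul]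
    | basis w =>
      rw [consOp_word, mulOp_word, wordMul]
      simp only [mulOp_word]
      rfl

/-- `(D_j u)⟨m⟩y = -m_j u⟨m - e_j⟩y`. -/
theorem mulOp_derivOp {a b : B} (j : Fin n) (m : Fin n → ℕ) (u : NormalWord N a →₀ k)
    (y : NormalWord N b →₀ k) :
    mulOp m (derivOp j u) y = -((m j : k) • mulOp (m - Pi.single j 1) u y) := by
  induction u using word_induction with
  | zero => simp
  | add x z hx hz =>
    simp only [map_add, hx, hz, smul_add, LinearMap.add_apply]
    abel
  | smul c x hx => simp only [map_smul, hx, LinearMap.smul_apply, smul_neg, smul_comm c]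
  | basis u =>
  induction u generalizing m with
  | last a i =>
    rw [derivOp_last, mulOp_last, mulOp_last, falling_add_single, sgn_add, sgn_single, smul_smul,
      ← neg_smul, tsub_tsub, add_comm i]
    congr 1
    ring
  | @cons a b l hl u ih =>
    have hs := (tsub_le_self : l - Pi.single j 1 ≤ l).trans_lt hl
    rw [← consOp_word a ⟨l, hl⟩, ← letterOp_of_lt, derivOp_letterOp, map_add, map_neg, map_smul,
      LinearMap.add_apply, LinearMap.neg_apply, LinearMap.smul_apply, mulOp_letterOp_of_lt _ hl,
      mulOp_letterOp_of_lt _ hl, mulOp_letterOp_of_lt _ hs]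
    simp only [ih, map_neg, map_smul, bsum_neg]
    rw [bsum_deriv_snd (k := k) j (fun p q => letterOp a p (mulOp q (word k u) y))]
    abel

/-- The Leibniz rule with (D_j u)⟨m⟩y already eliminated; in this form the induction step is
`bsum_deriv`. -/
theorem derivOp_mulOp_aux {a b : B} (j : Fin n) (m : Fin n → ℕ) (u : NormalWord N a →₀ k)
    (y : NormalWord N b →₀ k) :
    derivOp j (mulOp m u y) = -((m j : k) • mulOp (m - Pi.single j 1) u y) +
      mulOp m u (derivOp j y) := by
  induction u using word_induction with
  | zero => simp
  | add x z hx hz =>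
    simp only [map_add, hx, hz, smul_add, LinearMap.add_apply]
    abel
  | smul c x hx => simp only [map_smul, hx, LinearMap.smul_apply, smul_neg, smul_add, smul_comm c]
  | basis u =>
  induction u generalizing m with
  | last a i =>
    rw [mulOp_last, mulOp_last, mulOp_last, map_smul, derivOp_letterOp, smul_add, smul_neg,
      smul_smul, smul_smul, tsub_tsub, tsub_tsub, add_comm i, mul_right_comm, mul_assoc,
      mul_comm (_ : k) (falling k m i), mul_left_comm (m j : k), ← falling_add_single j m i,
      falling_add_single' j m i]
    ring_nf
  | @cons a b l hl u ih =>
    rw [← consOp_word a ⟨l, hl⟩, ← letterOp_of_lt, mulOp_letterOp_of_lt _ hl,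
      mulOp_letterOp_of_lt _ hl, mulOp_letterOp_of_lt _ hl, map_bsum,
      ← bsum_deriv, ← bsum_neg, ← bsum_add]
    simp only [derivOp_letterOp, ih, map_add, map_neg, map_smul]
    congr 1
    funext p q
    abel

theorem derivOp_mulOp {a b : B} (j : Fin n) (m : Fin n → ℕ) (u : NormalWord N a →₀ k)
    (y : NormalWord N b →₀ k) :
    derivOp j (mulOp m u y) = mulOp m (derivOp j u) y + mulOp m u (derivOp j y) := by
  rw [mulOp_derivOp, derivOp_mulOp_aux]

/-- `(a⟨m⟩x)⟨m'⟩y = ∑_s (-1)^s binom(m,s) a⟨m - s⟩(x⟨m' + s⟩y)` for all indices `m`. -/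
theorem mulOp_letterOp {a b c : B} (m m' : Fin n → ℕ) (x : NormalWord N b →₀ k)
    (y : NormalWord N c →₀ k) :
    mulOp m' (letterOp a m x) y = bsum k (fun p q => letterOp a p (mulOp q x y)) m m' := by
  induction x using word_induction with
  | zero => simp [bsum]
  | add x z hx hz => simp only [map_add, hx, hz, bsum_add, LinearMap.add_apply]
  | smul c x hx => simp only [map_smul, hx, bsum_smul, LinearMap.smul_apply]
  | basis x =>
  induction x generalizing a m m' with
  | last b i =>
    induction i using multiIndex_induction generalizing m m' with
    | zero =>
      by_cases hm : m < N a b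
      · exact mulOp_letterOp_of_lt m' hm _ y
      · simp only [letterOp_last_zero hm, mulOp_last_zero, bsum_letterOp a b hm, map_zero,
          LinearMap.zero_apply]
    | add_single i j ih =>
      have h := derivOp_letterOp (k := k) j a m (.single (.last b i : NormalWord N b) 1)
      rw [← word, derivOp_last] at h
      rw [← derivOp_last]
      simp only [mulOp_derivOp, map_neg, map_smul, bsum_neg]
      rw [bsum_deriv_snd (k := k) j
        (fun p q => letterOp a p (mulOp q (word k (.last b i : NormalWord N b)) y)),
        ← ih, ← ih, derivOp_last, eq_add_of_neg_add_eq h.symm, map_add, map_smul,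
        LinearMap.add_apply, LinearMap.smul_apply, mulOp_derivOp]
      abel
  | @cons b d r hr v ih =>
    rw [← consOp_word b ⟨r, hr⟩, ← letterOp_of_lt, letterOp_letterOp_of_lt a b m hr]
    let F : (Fin n → ℕ) → (Fin n → ℕ) → (Fin n → ℕ) → (NormalWord N a →₀ k) :=
      fun i j t => letterOp a i (letterOp b j (mulOp t (word k v) y))
    let G : (Fin n → ℕ) → (Fin n → ℕ) → (NormalWord N a →₀ k) :=
      fun m q => bsum k (fun i t => bsum k (fun j t => F i j t) q t) m m'
    -- `bsum_comp` regroups the nested sum so that the inner one is the locality relation of a and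
    -- b. Hence G is recovered from its reduction, which is what the left side expands to.
    have hG : ∀ m, ¬ m < N a b → ∀ q, bsum k G m q = 0 := by
      intro m hm q
      rw [bsum_comp]
      simp only [F, bsum_letterOp a b hm, bsum_zero]
    have h1 : mulOp m' (reduceSum k (N a b)
        (fun l q => consOp a l (letterOp b q (word k v))) m r) y =
          reduceSum k (N a b) (fun l q => G l.1 q) m r := by
      rw [← LinearMap.flip_apply, map_reduceSum]
      congr 1
      funext l q
      rw [LinearMap.flip_apply, ← letterOp_of_lt a l.2, mulOp_letterOp_of_lt _ l.2]
      simp only [ih, map_bsum, G, F]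
    rw [h1, ← eq_reduceSum hG]
    simp only [mulOp_letterOp_of_lt _ hr, map_bsum, G, F]

/-- Induction on u: a letter is `mulOp_letterOp`, derivatives pass through `mulOp_derivOp`, and for
u = a⟨l⟩u' both sides are nested binomial sums identified by `bsum_comp`. -/
theorem mulOp_mulOp {a b c : B} (m m' : Fin n → ℕ) (u : NormalWord N a →₀ k)
    (x : NormalWord N b →₀ k) (y : NormalWord N c →₀ k) :
    mulOp m' (mulOp m u x) y = bsum k (fun p q => mulOp p u (mulOp q x y)) m m' := by
  induction u using word_induction with
  | zero => simp [bsum]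
  | add u z hu hz => simp only [map_add, hu, hz, bsum_add, LinearMap.add_apply]
  | smul c u hu => simp only [map_smul, hu, bsum_smul, LinearMap.smul_apply]
  | basis u =>
  induction u generalizing m m' with
  | last a i =>
    induction i using multiIndex_induction generalizing m m' with
    | zero => simp only [mulOp_last_zero, mulOp_letterOp]
    | add_single i j ih =>
      rw [← derivOp_last]
      simp only [mulOp_derivOp, bsum_neg, map_neg, map_smul, LinearMap.neg_apply,
        LinearMap.smul_apply, ih]
      rw [bsum_deriv_fst (k := k) j
        (fun p q => mulOp p (word k (.last a i : NormalWord N a)) (mulOp q x y))]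
  | @cons a b l hl u ih =>
    rw [← consOp_word a ⟨l, hl⟩, ← letterOp_of_lt, mulOp_letterOp_of_lt _ hl,
      ← LinearMap.flip_apply, map_bsum]
    simp only [LinearMap.flip_apply, mulOp_letterOp, ih, map_bsum]
    exact bsum_comp (fun i j t => letterOp a i (mulOp j (word k u) (mulOp t x y))) l m m'

end Products

/-! ### Vanishing of products at large indices. -/

section Vanishing

variable {k : Type*} [Field k] {n : ℕ} {B : Type*} {N : B → B → Fin n → ℕ}

/-- Each D_j on the last letter raises the bound by e_j. On b⟨r⟩v, reduction leaves l ≺ N(a,b) in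
front and moves m - l into the second index, so an m not below K + N(a,b) makes every b⟨r + (m -
l)⟩v zero. -/
theorem exists_letterOp_eq_zero (a : B) {b : B} (x : NormalWord N b →₀ k) :
    ∃ K : Fin n → ℕ, ∀ m, ¬ m ≤ K → letterOp a m x = 0 := by
  induction x using word_induction with
  | zero => exact ⟨0, fun m _ => map_zero _⟩
  | add x y hx hy =>
    obtain ⟨K, hK⟩ := hx
    obtain ⟨L, hL⟩ := hy
    refine ⟨K + L, fun m hm => ?_⟩
    rw [map_add, hK m fun h => hm (h.trans le_self_add),
      hL m fun h => hm (h.trans le_add_self), add_zero]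
  | smul c x hx =>
    obtain ⟨K, hK⟩ := hx
    exact ⟨K, fun m hm => by rw [map_smul, hK m hm, smul_zero]⟩
  | basis w =>
  induction w generalizing a with
  | last b i =>
    induction i using multiIndex_induction with
    | zero => exact ⟨N a b, fun m hm => letterOp_last_zero fun h => hm h.le⟩
    | add_single i j ih =>
      obtain ⟨K, hK⟩ := ih
      refine ⟨K + Pi.single j 1, fun m hm => ?_⟩
      have h := derivOp_letterOp j a m (word k (.last b i : NormalWord N b))
      rw [hK m fun h => hm (h.trans le_self_add),
        hK (m - Pi.single j 1) fun h => hm (tsub_le_iff_right.mp h), map_zero, smul_zero, neg_zero,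
        zero_add, derivOp_last] at h
      exact h.symm
  | @cons b c r hr v ih =>
    obtain ⟨K, hK⟩ := ih b
    refine ⟨K + N a b, fun m hm => ?_⟩
    rw [← consOp_word b ⟨r, hr⟩, ← letterOp_of_lt, letterOp_letterOp_of_lt a b m hr, reduceSum]
    refine Finset.sum_eq_zero fun l _ => ?_
    have : ¬ r + (m - l.1) ≤ K := fun h => hm <|
      (tsub_le_iff_right.mp (le_add_self.trans h)).trans (add_le_add_right l.2.le K)
    simp only [hK _ this, map_zero, smul_zero]

theorem exists_mulOp_eq_zero {a b : B} (u : NormalWord N a →₀ k) (y : NormalWord N b →₀ k) :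
    ∃ K : Fin n → ℕ, ∀ m, ¬ m ≤ K → mulOp m u y = 0 := by
  induction u using word_induction with
  | zero => exact ⟨0, fun m _ => by rw [map_zero, LinearMap.zero_apply]⟩
  | add x z hx hz =>
    obtain ⟨K, hK⟩ := hx
    obtain ⟨L, hL⟩ := hz
    refine ⟨K + L, fun m hm => ?_⟩
    rw [map_add, LinearMap.add_apply, hK m fun h => hm (h.trans le_self_add),
      hL m fun h => hm (h.trans le_add_self), add_zero]
  | smul c x hx =>
    obtain ⟨K, hK⟩ := hx
    exact ⟨K, fun m hm => by rw [map_smul, LinearMap.smul_apply, hK m hm, smul_zero]⟩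
  | basis u =>
  induction u with
  | last a i =>
    obtain ⟨K, hK⟩ := exists_letterOp_eq_zero a y
    refine ⟨K + i, fun m hm => ?_⟩
    rw [mulOp_last, hK _ fun h => hm (tsub_le_iff_right.mp h), smul_zero]
  | @cons a b l hl u ih =>
    obtain ⟨K, hK⟩ := ih
    refine ⟨K, fun m hm => ?_⟩
    rw [← consOp_word a ⟨l, hl⟩, ← letterOp_of_lt, mulOp_letterOp_of_lt _ hl, bsum]
    refine Finset.sum_eq_zero fun s _ => ?_
    -- The inner indices are m + s ≥ m, so the bound for the tail u also serves a⟨l⟩u.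
    rw [hK _ fun h => hm (le_self_add.trans h), map_zero, smul_zero]

end Vanishing

/-! ### The free space is an associative conformal algebra generated by the letters. -/

section Free

variable {k : Type*} [Field k] {n : ℕ} {B : Type*} {N : B → B → Fin n → ℕ}

/-- The inclusion of the combinations of normal words with first letter `a`. -/
noncomputable def emb (a : B) : (NormalWord N a →₀ k) →ₗ[k] FreeSpace k N :=
  Finsupp.lmapDomain k k (Sigma.mk a)

theorem emb_word {a : B} (w : NormalWord N a) : emb a (word k w) = Finsupp.single ⟨a, w⟩ 1 := by
  simp [emb, word]

theorem gen_eq_emb (b : B) : gen k N b = emb b (word k (.last b 0)) := by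
  rw [emb_word, gen]

theorem freeSpace_induction {P : FreeSpace k N → Prop} (x : FreeSpace k N)
    (zero : P 0) (add : ∀ x y, P x → P y → P (x + y)) (emb : ∀ a x, P (emb a x)) : P x := by
  refine Finsupp.induction_linear x zero add fun w c => ?_
  have := emb w.1 (c • word k w.2)
  rwa [map_smul, emb_word, Finsupp.smul_single, smul_eq_mul, mul_one] at this

theorem freeOps_D_emb (t : Fin n) (a : B) (x : NormalWord N a →₀ k) :
    (freeOps k N).D t (emb a x) = emb a (derivOp t x) := by
  induction x using word_induction with
  | zero => simp
  | add x y hx hy => simp only [map_add, hx, hy]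
  | smul c x hx => simp only [map_smul, hx]
  | basis w =>
    rw [emb_word, derivOp_word]
    simp [freeOps, emb]

theorem freeOps_prod_emb (m : Fin n → ℕ) (a b : B) (x : NormalWord N a →₀ k)
    (y : NormalWord N b →₀ k) :
    (freeOps k N).prod m (emb a x) (emb b y) = emb a (mulOp m x y) := by
  induction x using word_induction with
  | zero => simp
  | add x z hx hz => simp only [map_add, hx, hz, LinearMap.add_apply]
  | smul c x hx => simp only [map_smul, hx, LinearMap.smul_apply]
  | basis u =>
    induction y using word_induction with
    | zero => simp
    | add x z hx hz => simp only [map_add, hx, hz]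
    | smul c x hx => simp only [map_smul, hx]
    | basis w =>
      rw [emb_word, emb_word, mulOp_word]
      simp [freeOps, emb]

theorem isAssocConformal_freeOps (hn : 0 < n) : (freeOps k N).IsAssocConformal where
  D_comm i j a := by
    induction a using freeSpace_induction with
    | zero => simp
    | add x y hx hy => simp only [map_add, hx, hy]
    | emb a x => simp only [freeOps_D_emb, derivOp_comm i j]
  locality a b := by
    have h : ∃ K : Fin n → ℕ, ∀ m, ¬ m ≤ K → (freeOps k N).prod m a b = 0 := by
      induction a using freeSpace_induction with
      | zero => exact ⟨0, fun m _ => by rw [map_zero, LinearMap.zero_apply]⟩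
      | add x z hx hz =>
        obtain ⟨K, hK⟩ := hx
        obtain ⟨L, hL⟩ := hz
        refine ⟨K + L, fun m hm => ?_⟩
        rw [map_add, LinearMap.add_apply, hK m fun h => hm (h.trans le_self_add),
          hL m fun h => hm (h.trans le_add_self), add_zero]
      | emb a x =>
        induction b using freeSpace_induction with
        | zero => exact ⟨0, fun m _ => map_zero _⟩
        | add x y hx hy =>
          obtain ⟨K, hK⟩ := hx
          obtain ⟨L, hL⟩ := hy
          refine ⟨K + L, fun m hm => ?_⟩
          rw [map_add, hK m fun h => hm (h.trans le_self_add),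
            hL m fun h => hm (h.trans le_add_self), add_zero]
        | emb b y =>
          obtain ⟨K, hK⟩ := exists_mulOp_eq_zero x y
          exact ⟨K, fun m hm => by rw [freeOps_prod_emb, hK m hm, map_zero]⟩
    obtain ⟨K, hK⟩ := h
    -- m ≤ K gives m ≺ K + 1; strictness needs a coordinate, which n > 0 supplies.
    refine ⟨K + 1, fun m hm => hK m fun h => hm (Pi.lt_def.mpr ⟨h.trans le_self_add, ⟨0, hn⟩, ?_⟩)⟩
    exact Nat.lt_succ_of_le (h _)
  leibniz i m a b := by
    induction a using freeSpace_induction with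
    | zero => simp
    | add x z hx hz =>
      simp only [map_add, hx, hz, LinearMap.add_apply]
      abel
    | emb a x =>
      induction b using freeSpace_induction with
      | zero => simp
      | add x z hx hz =>
        simp only [map_add, hx, hz]
        abel
      | emb b y => simp only [freeOps_D_emb, freeOps_prod_emb, derivOp_mulOp, map_add]
  D_prod i m a b := by
    induction a using freeSpace_induction with
    | zero => simp
    | add x z hx hz =>
      simp only [map_add, hx, hz, LinearMap.add_apply, smul_add]
      abel
    | emb a x =>
      induction b using freeSpace_induction with
      | zero => simp
      | add x z hx hz =>
        simp only [map_add, hx, hz, smul_add]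
        abel
      | emb b y => simp only [freeOps_D_emb, freeOps_prod_emb, mulOp_derivOp, map_neg, map_smul]
  assoc m m' a b c := by
    change _ = bsum k (fun p q => (freeOps k N).prod p a ((freeOps k N).prod q b c)) m m'
    induction a using freeSpace_induction with
    | zero => simp [bsum]
    | add x z hx hz => simp only [map_add, hx, hz, LinearMap.add_apply, bsum_add]
    | emb a x =>
      induction b using freeSpace_induction with
      | zero => simp [bsum]
      | add x z hx hz => simp only [map_add, hx, hz, LinearMap.add_apply, bsum_add]
      | emb b y =>
        induction c using freeSpace_induction with
        | zero => simp [bsum]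
        | add x z hx hz => simp only [map_add, hx, hz, bsum_add]
        | emb c z => simp only [freeOps_prod_emb, mulOp_mulOp, map_bsum]

theorem localMap_gen : LocalMap N (freeOps k N) (gen k N) := by
  intro a b m hm
  rw [gen_eq_emb, gen_eq_emb, freeOps_prod_emb, mulOp_last_zero, letterOp_last_zero hm, map_zero]

theorem generates_gen : Generates (freeOps k N) (gen k N) := by
  intro W hgen hD hprod
  refine Submodule.eq_top_iff'.mpr fun x => ?_
  induction x using freeSpace_induction with
  | zero => exact W.zero_mem
  | add x y hx hy => exact W.add_mem hx hy
  | emb a x =>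
    induction x using word_induction with
    | zero => rw [map_zero]; exact W.zero_mem
    | add x y hx hy => rw [map_add]; exact W.add_mem hx hy
    | smul c x hx => rw [map_smul]; exact W.smul_mem c hx
    | basis w =>
    induction w with
    | last b i =>
      induction i using multiIndex_induction with
      | zero => rw [← gen_eq_emb]; exact hgen b
      | add_single i j ih =>
        rw [← derivOp_last, ← freeOps_D_emb]
        exact hD j _ ih
    | @cons a b m hm v ih =>
      rw [← consOp_word a ⟨m, hm⟩, ← letterOp_of_lt, ← mulOp_last_zero, ← freeOps_prod_emb,
        ← gen_eq_emb]
      exact hprod m _ (hgen a) _ ih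

end Free

/-! ### The universal property. -/

section Universal

variable {k : Type*} [Field k] {n : ℕ} {B : Type*} {N : B → B → Fin n → ℕ}
  {C : Type*} [AddCommGroup C] [Module k C]

/-- The multi-index powers of a commuting family. -/
theorem exists_multiIndex_pow {M : Type*} [Monoid M] (D : Fin n → M)
    (h : ∀ i j, Commute (D i) (D j)) :
    ∃ P : (Fin n → ℕ) → M, P 0 = 1 ∧ ∀ i t, P (i + Pi.single t 1) = D t * P i := by
  -- Endomorphisms do not commute in general, so ∏ D_j^{i_j} is formed as a monoid homomorphism from
  -- ℕ^n built from pairwise commuting powers; multiplicativity gives the recursion.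
  let φ : (∀ _ : Fin n, Multiplicative ℕ) →* M :=
    MonoidHom.noncommPiCoprod (fun j => powersHom M (D j)) fun i j _ x y => by
      simpa using (h i j).pow_pow _ _
  refine ⟨fun i => φ fun j => Multiplicative.ofAdd (i j), map_one φ, fun i t => ?_⟩
  have e : (fun j => Multiplicative.ofAdd ((i + Pi.single t 1 : Fin n → ℕ) j)) =
      Pi.mulSingle t (Multiplicative.ofAdd 1) * fun j => Multiplicative.ofAdd (i j) := by
    funext j
    rcases eq_or_ne j t with rfl | hj
    · simp [mul_comm]
    · simp [hj]
  simp only [e, map_mul]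
  congr 1
  refine (MonoidHom.noncommPiCoprod_mulSingle _ t _).trans ?_
  simp

/-- The value of a normal word in a conformal algebra; `P i` plays the role of `D^i`. -/
noncomputable def evalWord (S : Ops k n C) (P : (Fin n → ℕ) → Module.End k C) (ε : B → C) :
    {a : B} → NormalWord N a → C
  | _, .last b i => P i (ε b)
  | _, .cons a m _ w => S.prod m (ε a) (evalWord S P ε w)

/-- The linear extension of the evaluation of normal words. -/
noncomputable def evalOp (S : Ops k n C) (P : (Fin n → ℕ) → Module.End k C) (ε : B → C) {a : B} :
    (NormalWord N a →₀ k) →ₗ[k] C :=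
  Finsupp.linearCombination k (evalWord S P ε)

variable {S : Ops k n C} {P : (Fin n → ℕ) → Module.End k C} {ε : B → C}

theorem evalOp_word {a : B} (w : NormalWord N a) :
    evalOp S P ε (word k w) = evalWord S P ε w := by
  simp [evalOp, word]

theorem evalOp_letterOp_of_lt (a : B) {b : B} {m : Fin n → ℕ} (hm : m < N a b)
    (x : NormalWord N b →₀ k) :
    evalOp S P ε (letterOp a m x) = S.prod m (ε a) (evalOp S P ε x) := by
  rw [letterOp_of_lt a hm]
  induction x using word_induction with
  | zero => simp
  | add x y hx hy => simp only [map_add, hx, hy]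
  | smul c x hx => simp only [map_smul, hx]
  | basis w => rw [consOp_word, evalOp_word, evalOp_word, evalWord]

theorem D_prod_apply (hS : S.IsAssocConformal) (t : Fin n) (m : Fin n → ℕ) (x y : C) :
    S.D t (S.prod m x y) =
      -((m t : k) • S.prod (m - Pi.single t 1) x y) + S.prod m x (S.D t y) := by
  rw [hS.leibniz, hS.D_prod]

theorem evalOp_derivOp (hS : S.IsAssocConformal)
    (hP : ∀ i t, P (i + Pi.single t 1) = S.D t * P i) (t : Fin n) {a : B}
    (x : NormalWord N a →₀ k) :
    evalOp S P ε (derivOp t x) = S.D t (evalOp S P ε x) := by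
  induction x using word_induction with
  | zero => simp
  | add x y hx hy => simp only [map_add, hx, hy]
  | smul c x hx => simp only [map_smul, hx]
  | basis w =>
  induction w with
  | last b i => rw [derivOp_last, evalOp_word, evalOp_word, evalWord, evalWord, hP]; rfl
  | @cons a b m hm v ih =>
    rw [← consOp_word a ⟨m, hm⟩, ← letterOp_of_lt, derivOp_letterOp, map_add, map_neg, map_smul,
      evalOp_letterOp_of_lt a hm, evalOp_letterOp_of_lt a hm,
      evalOp_letterOp_of_lt a (tsub_le_self.trans_lt hm), D_prod_apply hS, ih]

/-- Each rewriting rule for a⟨m⟩w is an identity in the target: locality of the images for a bare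
last letter, the Leibniz rule for D^i b, and index reduction for longer words. -/
theorem evalOp_letterOp (hS : S.IsAssocConformal) (hP0 : P 0 = 1)
    (hP : ∀ i t, P (i + Pi.single t 1) = S.D t * P i) (hε : LocalMap N S ε) (a : B) {b : B}
    (m : Fin n → ℕ) (x : NormalWord N b →₀ k) :
    evalOp S P ε (letterOp a m x) = S.prod m (ε a) (evalOp S P ε x) := by
  induction x using word_induction with
  | zero => simp
  | add x y hx hy => simp only [map_add, hx, hy]
  | smul c x hx => simp only [map_smul, hx]
  | basis w =>
  induction w generalizing a m with
  | last b i =>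
    induction i using multiIndex_induction generalizing m with
    | zero =>
      by_cases hm : m < N a b
      · exact evalOp_letterOp_of_lt a hm _
      · rw [letterOp_last_zero hm, map_zero, evalOp_word, evalWord, hP0, Module.End.one_apply,
          hε a b m hm]
    | add_single i j ih =>
      have h := derivOp_letterOp j a m (word k (.last b i : NormalWord N b))
      have h' := D_prod_apply hS j m (ε a) (evalOp S P ε (word k (.last b i : NormalWord N b)))
      rw [← derivOp_last, eq_add_of_neg_add_eq h.symm, map_add, map_smul, evalOp_derivOp hS hP,
        evalOp_derivOp hS hP, ih, ih, h']
      abel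
  | @cons b c r hr v ih =>
    rw [← consOp_word b ⟨r, hr⟩, ← letterOp_of_lt, letterOp_letterOp_of_lt a b m hr, map_reduceSum,
      evalOp_letterOp_of_lt b hr]
    -- Associativity in the target applied to ε(a)⟨m⟩ε(b) = 0, so `eq_reduceSum` reduces with the
    -- same coefficients as in the free space.
    have hG : ∀ m, ¬ m < N a b → ∀ q, bsum k
        (fun m q => S.prod m (ε a) (S.prod q (ε b) (evalOp S P ε (word k v)))) m q = 0 := by
      intro m hm q
      have := hS.assoc m q (ε a) (ε b) (evalOp S P ε (word k v))
      rw [hε a b m hm, map_zero, LinearMap.zero_apply] at this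
      exact this.symm
    rw [eq_reduceSum (k := k)
      (G := fun m q => S.prod m (ε a) (S.prod q (ε b) (evalOp S P ε (word k v)))) hG m r]
    congr 1
    funext l q
    rw [← letterOp_of_lt a l.2, evalOp_letterOp_of_lt a l.2, ih]

theorem evalOp_mulOp (hS : S.IsAssocConformal) (hP0 : P 0 = 1)
    (hP : ∀ i t, P (i + Pi.single t 1) = S.D t * P i) (hε : LocalMap N S ε) {a b : B}
    (m : Fin n → ℕ) (u : NormalWord N a →₀ k) (y : NormalWord N b →₀ k) :
    evalOp S P ε (mulOp m u y) = S.prod m (evalOp S P ε u) (evalOp S P ε y) := by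
  induction u using word_induction with
  | zero => simp
  | add x z hx hz => simp only [map_add, hx, hz, LinearMap.add_apply]
  | smul c x hx => simp only [map_smul, hx, LinearMap.smul_apply]
  | basis u =>
  induction u generalizing m with
  | last a i =>
    induction i using multiIndex_induction generalizing m with
    | zero =>
      rw [mulOp_last_zero, evalOp_letterOp hS hP0 hP hε, evalOp_word (.last a 0), evalWord, hP0,
        Module.End.one_apply]
    | add_single i j ih =>
      rw [← derivOp_last, mulOp_derivOp, map_neg, map_smul, ih, evalOp_derivOp hS hP, hS.D_prod]
  | @cons a b l hl u ih =>
    rw [← consOp_word a ⟨l, hl⟩, ← letterOp_of_lt, mulOp_letterOp_of_lt _ hl, map_bsum,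
      evalOp_letterOp_of_lt a hl, hS.assoc]
    simp only [evalOp_letterOp hS hP0 hP hε, ih]
    rfl

/-- The extension of `ε` to a linear map on the free algebra. -/
noncomputable def freeLift (N : B → B → Fin n → ℕ) (S : Ops k n C)
    (P : (Fin n → ℕ) → Module.End k C) (ε : B → C) : FreeSpace k N →ₗ[k] C :=
  Finsupp.linearCombination k fun w => evalWord S P ε w.2

theorem freeLift_emb (a : B) (x : NormalWord N a →₀ k) :
    freeLift N S P ε (emb a x) = evalOp S P ε x := by
  induction x using word_induction with
  | zero => simp
  | add x y hx hy => simp only [map_add, hx, hy]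
  | smul c x hx => simp only [map_smul, hx]
  | basis w => rw [emb_word, evalOp_word]; simp [freeLift]

theorem isHom_freeLift (hS : S.IsAssocConformal) (hP0 : P 0 = 1)
    (hP : ∀ i t, P (i + Pi.single t 1) = S.D t * P i) (hε : LocalMap N S ε) :
    IsHom (freeOps k N) S (freeLift N S P ε) where
  map_prod m a b := by
    induction a using freeSpace_induction with
    | zero => simp
    | add x z hx hz => simp only [map_add, hx, hz, LinearMap.add_apply]
    | emb a x =>
      induction b using freeSpace_induction with
      | zero => simp
      | add x z hx hz => simp only [map_add, hx, hz]
      | emb b y => simp only [freeOps_prod_emb, freeLift_emb, evalOp_mulOp hS hP0 hP hε]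
  map_D i a := by
    induction a using freeSpace_induction with
    | zero => simp
    | add x z hx hz => simp only [map_add, hx, hz]
    | emb a x => simp only [freeOps_D_emb, freeLift_emb, evalOp_derivOp hS hP]

/-- Homomorphisms that agree on generators are equal. -/
theorem Generates.hom_ext {A : Type*} [AddCommGroup A] [Module k A] {T : Ops k n A} {ι : B → A}
    (hT : Generates T ι) {f g : A →ₗ[k] C} (hf : IsHom T S f) (hg : IsHom T S g)
    (h : ∀ b, f (ι b) = g (ι b)) : f = g := by
  refine LinearMap.eqLocus_eq_top.mp (hT (LinearMap.eqLocus f g) h (fun i x hx => ?_)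
    fun m x hx y hy => ?_)
  · rw [LinearMap.mem_eqLocus] at hx ⊢
    rw [hf.map_D, hg.map_D, hx]
  · rw [LinearMap.mem_eqLocus] at hx hy ⊢
    rw [hf.map_prod, hg.map_prod, hx, hy]

theorem existsUnique_hom_freeOps (hS : S.IsAssocConformal) (hε : LocalMap N S ε) :
    ∃! f : FreeSpace k N →ₗ[k] C, IsHom (freeOps k N) S f ∧ ∀ b, f (gen k N b) = ε b := by
  obtain ⟨P, hP0, hP⟩ := exists_multiIndex_pow (M := Module.End k C) S.D fun i j =>
    LinearMap.ext fun x => hS.D_comm i j x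
  have hgen : ∀ b, freeLift N S P ε (gen k N b) = ε b := fun b => by
    rw [gen_eq_emb, freeLift_emb, evalOp_word, evalWord, hP0, Module.End.one_apply]
  refine ⟨freeLift N S P ε, ⟨isHom_freeLift hS hP0 hP hε, hgen⟩, fun f hf => ?_⟩
  exact generates_gen.hom_ext hf.1 (isHom_freeLift hS hP0 hP hε) fun b => by rw [hf.2, hgen]

end Universal

end NConformal

theorem mainTheorem1 (k : Type*) [Field k] [CharZero k] (n : ℕ) (hn : 0 < n)
    (B : Type*) [Nonempty B] (N : B → B → Fin n → ℕ) :
    NConformal.IsFree.{w} N (NConformal.freeOps k N) (NConformal.gen k N) where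
  isAssocConformal := NConformal.isAssocConformal_freeOps hn
  generates := NConformal.generates_gen
  localMap := NConformal.localMap_gen
  existsUnique_hom _ _ _ _ hS _ hε := NConformal.existsUnique_hom_freeOps hS hε
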